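/- A \emph{weighted game graph} $(G,w)$ is a nonempty finite directed graph $G=(V,E)$ in which every node has out-degree at least one, together with a partition $V=V_A\cup V_B$ of the nodes between two players, Alice and Bob, and integer edge weights $w:E\to\mathbb Z$. A positional strategy of a player maps each of the player's nodes to one of its out-neighbours. A pair of strategies $(\sigma,\tau)$ of Alice and Bob and a node $s$ determine an infinite path from $s$; let $w(P_i)$ be the total weight of its first $i$ edges, and let $e^*_{\sigma,\tau}(s)\in\mathbb N\cup\{\infty\}$ be the least $e\in\mathbb N$ with $e+w(P_i)\ge 0$ for all $i\ge 0$ (and $\infty$ if there is none). The \emph{minimal energy} at $s$ is $e^*_{G,w}(s)=\min_\sigma\max_\tau e^*_{\sigma,\tau}(s)$. The \emph{value problem} of energy games is to compute $e^*_{G,w}(s)$ for all nodes $s$ of a given $(G,w)$; the \emph{decision problem} is to decide, given $(G,w)$ and $s$, whether $e^*_{G,w}(s)<\infty$. Weights are written in binary. The problem on a class of graphs is the one whose inputs are promised to lie in the class. The \emph{clique-width} of $G$ (ignoring the owners of the nodes) is the least number of labels with which $G$ can be built by: creating a node with label $i$; disjoint union of labelled graphs; adding all edges $(u,v)$ from nodes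 $u$ with label $i$ to nodes $v$ with label $j$, where $i\ne j$; renaming label $i$ to $j$. An \emph{ergodic partition} of $G$ is a partition $V=S_A\cup S_B$ such that every node of Alice in $S_A$ has an edge into $S_A$, no node of Bob in $S_A$ has an edge into $S_B$, every node of Bob in $S_B$ has an edge into $S_B$, and no node of Alice in $S_B$ has an edge into $S_A$. $G$ is \emph{ergodic} if in every ergodic partition $S_A$ or $S_B$ is empty, and \emph{strongly ergodic} if every induced subgraph in which all out-degrees are at least one is ergodic. $G$ is \emph{complete bipartite} if $(u,v)\in E$ exactly when $u$ and $v$ belong to different players. Two decision problems are polynomial-time equivalent if each is polynomial-time many-one reducible to the other; two function problems are polynomial-time equivalent if each can be solved in polynomial time with an oracle for the other (polynomial-time Turing reducibility, where the oracle may be any function that answers all inputs in the promised class correctly). \textbf{Theorem.} The energy game problem on arbitrary weighted game graphs is polynomial-time equivalent, both for the decision problem and for the value problem, to (a) the energy game problem on graphs of clique-width at most $k$, for every fixed $k\ge 2$; (b) the energy game problem on strongly ergodic graphs; (c) the energy game problem on complete bipartite graphs. Moreover, every complete bipartite weighted game graph has clique-width $2$ and is strongly ergodic. -/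

import Mathlib

namespace EnergyGames

/-! ### Game graphs -/

/-- The structure of a game graph: a directed graph on `V` whose nodes are divided between two
players. `alice u = true` means that `u` belongs to Alice, `alice u = false` that it belongs to
Bob. -/
structure GameGraph (V : Type) where
  alice : V → Bool
  Adj : V → V → Prop

namespace GameGraph

variable {V : Type}

/-- The subgraph induced by a set of nodes. -/
def induce (G : GameGraph V) (U : Set V) : GameGraph U where
  alice u := G.alice u
  Adj u v := G.Adj u v

/-- Every node has out-degree at least one. -/
def OutDegreePos (G : GameGraph V) : Prop := ∀ u, ∃ v, G.Adj u v

/-- Ergodic partitions `(SA, SB)`. -/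
structure IsErgodicPartition (G : GameGraph V) (SA SB : Set V) : Prop where
  disjoint : Disjoint SA SB
  cover : SA ∪ SB = Set.univ
  /-- Alice can keep the play inside `SA`. -/
  alice_stays : ∀ u ∈ SA, G.alice u = true → ∃ v ∈ SA, G.Adj u v
  /-- Bob cannot leave `SA`. -/
  bob_confined : ∀ u ∈ SA, G.alice u = false → ∀ v ∈ SB, ¬ G.Adj u v
  /-- Bob can keep the play inside `SB`. -/
  bob_stays : ∀ u ∈ SB, G.alice u = false → ∃ v ∈ SB, G.Adj u v
  /-- Alice cannot leave `SB`. -/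
  alice_confined : ∀ u ∈ SB, G.alice u = true → ∀ v ∈ SA, ¬ G.Adj u v

/-- Every ergodic partition is trivial. -/
def IsErgodic (G : GameGraph V) : Prop :=
  ∀ SA SB : Set V, G.IsErgodicPartition SA SB → SA = ∅ ∨ SB = ∅

/-- Every induced subgraph in which all out-degrees are positive is ergodic. -/
def IsStronglyErgodic (G : GameGraph V) : Prop :=
  ∀ U : Set V, (G.induce U).OutDegreePos → (G.induce U).IsErgodic

/-- Complete bipartite game graphs: no edge joins two nodes of the same player, and all edges
(in both directions) between nodes of different players are present. -/
def IsCompleteBipartite (G : GameGraph V) : Prop :=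
  (∀ u v, G.alice u = G.alice v → ¬ G.Adj u v) ∧
    ∀ u v, G.alice u ≠ G.alice v → G.Adj u v

end GameGraph

/-! ### Clique-width of directed graphs -/

/-- Expressions that build labelled directed graphs with labels in `Fin k`: a single node with
label `i`; disjoint union; adding all edges from nodes with label `i` to nodes with label `j`
(for `i ≠ j`); renaming label `i` to `j`. -/
inductive CliqueExpr (k : ℕ) : Type
  | node (i : Fin k) : CliqueExpr k
  | union (e f : CliqueExpr k) : CliqueExpr k
  | join (i j : Fin k) (hij : i ≠ j) (e : CliqueExpr k) : CliqueExpr k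
  | relabel (i j : Fin k) (e : CliqueExpr k) : CliqueExpr k

namespace CliqueExpr

variable {k : ℕ}

/-- The nodes of the graph built by an expression. -/
def Vert : CliqueExpr k → Type
  | node _ => Unit
  | union e f => e.Vert ⊕ f.Vert
  | join _ _ _ e => e.Vert
  | relabel _ _ e => e.Vert

/-- The labels of the nodes of the graph built by an expression. -/
def label : (e : CliqueExpr k) → e.Vert → Fin k
  | node i, _ => i
  | union e _, Sum.inl u => e.label u
  | union _ f, Sum.inr v => f.label v
  | join _ _ _ e, u => e.label u
  | relabel i j e, u => if e.label u = i then j else e.label u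

/-- The edges of the graph built by an expression. -/
def Adj : (e : CliqueExpr k) → e.Vert → e.Vert → Prop
  | node _, _, _ => False
  | union e _, Sum.inl u, Sum.inl v => e.Adj u v
  | union _ f, Sum.inr u, Sum.inr v => f.Adj u v
  | union _ _, Sum.inl _, Sum.inr _ => False
  | union _ _, Sum.inr _, Sum.inl _ => False
  | join i j _ e, u, v => e.Adj u v ∨ (e.label u = i ∧ e.label v = j)
  | relabel _ _ e, u, v => e.Adj u v

end CliqueExpr

/-- The directed graph `G` can be built (up to isomorphism) with `k` labels. -/
def GameGraph.BuiltWithLabels {V : Type} (G : GameGraph V) (k : ℕ) : Prop :=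
  ∃ (e : CliqueExpr k) (φ : V ≃ e.Vert), ∀ u v, G.Adj u v ↔ e.Adj (φ u) (φ v)

/-- The clique-width: the minimum number of labels needed to build the graph (`⊤` if there is no
such number). The owners of the nodes play no role. -/
noncomputable def GameGraph.cliqueWidth {V : Type} (G : GameGraph V) : ℕ∞ :=
  ⨅ (k : ℕ) (_ : G.BuiltWithLabels k), (k : ℕ∞)

/-! ### Energy games -/

/-- A weighted game graph: a nonempty finite directed graph on the nodes `0, …, n - 1`, in which
every node has an owner and out-degree at least one, with integer edge weights.
`weight u v = none` means that there is no edge from `u` to `v`. -/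
structure EnergyGame where
  n : ℕ
  n_pos : 0 < n
  alice : Fin n → Bool
  weight : Fin n → Fin n → Option ℤ
  outDegree_pos : ∀ u, ∃ v, (weight u v).isSome

namespace EnergyGame

/-- The underlying unweighted game graph. -/
def graph (G : EnergyGame) : GameGraph (Fin G.n) where
  alice := G.alice
  Adj u v := (G.weight u v).isSome

/-- The positional strategies of a player (`true` for Alice, `false` for Bob): each node of the
player is mapped to one of its out-neighbours. -/
def Strategy (G : EnergyGame) (player : Bool) : Type :=
  {σ : {u : Fin G.n // G.alice u = player} → Fin G.n // ∀ u, G.graph.Adj u.1 (σ u)}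

/-- The unique out-neighbour of `u` in the graph `G(σ, τ)`. -/
def next (G : EnergyGame) (σ : G.Strategy true) (τ : G.Strategy false) (u : Fin G.n) : Fin G.n :=
  if h : G.alice u = true then σ.1 ⟨u, h⟩ else τ.1 ⟨u, Bool.eq_false_iff.mpr h⟩

/-- The total weight of the path with `i` edges that starts at `s` in `G(σ, τ)`. -/
def pathWeight (G : EnergyGame) (σ : G.Strategy true) (τ : G.Strategy false) (s : Fin G.n)
    (i : ℕ) : ℤ :=
  ∑ j ∈ Finset.range i,
    (G.weight ((G.next σ τ)^[j] s) ((G.next σ τ)^[j + 1] s)).getD 0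

/-- Alice wins the play of `σ` against `τ` from `s` with initial energy `e`: the energy never
becomes negative. -/
def AliceWinsPlay (G : EnergyGame) (σ : G.Strategy true) (τ : G.Strategy false) (s : Fin G.n)
    (e : ℕ) : Prop :=
  ∀ i : ℕ, 0 ≤ (e : ℤ) + G.pathWeight σ τ s i

/-- The minimal sufficient energy at `s` for a pair of strategies (`⊤` if no finite initial energy
suffices). -/
noncomputable def playEnergy (G : EnergyGame) (σ : G.Strategy true) (τ : G.Strategy false)
    (s : Fin G.n) : ℕ∞ :=
  ⨅ (e : ℕ) (_ : G.AliceWinsPlay σ τ s e), (e : ℕ∞)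

/-- The minimal sufficient energy at `s`: Alice minimizes and Bob maximizes, over positional
strategies. -/
noncomputable def minEnergy (G : EnergyGame) (s : Fin G.n) : ℕ∞ :=
  ⨅ σ : G.Strategy true, ⨆ τ : G.Strategy false, G.playEnergy σ τ s

/-- The encoding of a weighted game graph as a list of integers: the number of nodes, the owners
(`1` for Alice, `0` for Bob), and the weighted adjacency matrix row by row, with two numbers per
entry: `1, w` for an edge of weight `w`, and `0, 0` where there is no edge. -/
def encode (G : EnergyGame) : List ℤ :=
  (G.n : ℤ) ::
    ((List.finRange G.n).map (fun u => if G.alice u = true then (1 : ℤ) else 0) ++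
      (List.finRange G.n).flatMap fun u =>
        (List.finRange G.n).flatMap fun v =>
          match G.weight u v with
          | some w => [1, w]
          | none => [0, 0])

end EnergyGame

/-! ### A random-access machine with an oracle, under logarithmic cost -/

/-- Bit length of an integer (without its sign). -/
def bitSize (z : ℤ) : ℕ := z.natAbs.size

/-- Size of a list of integers written in binary. -/
def listSize (l : List ℤ) : ℕ := (l.map fun z => bitSize z + 1).sum

/-- A memory state: integer registers, and arrays of integers. A program mentions only finitely
many of each. -/
structure State where
  reg : ℕ → ℤ
  arr : ℕ → List ℤ

/-- Basic instructions. -/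
inductive Instr : Type
  /-- register `i` becomes the constant `c` -/
  | const (i : ℕ) (c : ℤ)
  /-- register `i` becomes the sum of the registers `j` and `k` -/
  | add (i j k : ℕ)
  /-- register `i` becomes the difference of the registers `j` and `k` -/
  | sub (i j k : ℕ)
  /-- register `i` becomes the length of array `a` -/
  | length (i a : ℕ)
  /-- register `i` becomes the entry of array `a` whose index is in register `j` -/
  | get (i a j : ℕ)
  /-- the entry of array `a` whose index is in register `j` becomes register `i` -/
  | put (a j i : ℕ)
  /-- register `i` is appended to array `a` -/
  | push (a i : ℕ)
  /-- array `a` becomes empty -/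
  | clear (a : ℕ)
  /-- the oracle is asked about the contents of array `a`; its answer replaces array `b` -/
  | query (a b : ℕ)

/-- The effect of a basic instruction, where `O` is the oracle. A negative index counts as `0`;
reading beyond the end of an array gives `0`, and writing there has no effect. -/
def Instr.effect (O : List ℤ → List ℤ) (s : State) : Instr → State
  | const i c => { s with reg := Function.update s.reg i c }
  | add i j k => { s with reg := Function.update s.reg i (s.reg j + s.reg k) }
  | sub i j k => { s with reg := Function.update s.reg i (s.reg j - s.reg k) }
  | length i a => { s with reg := Function.update s.reg i ((s.arr a).length : ℤ) }
  | get i a j => { s with reg := Function.update s.reg i ((s.arr a).getD (s.reg j).toNat 0) }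
  | put a j i =>
      { s with arr := Function.update s.arr a ((s.arr a).set (s.reg j).toNat (s.reg i)) }
  | push a i => { s with arr := Function.update s.arr a (s.arr a ++ [s.reg i]) }
  | clear a => { s with arr := Function.update s.arr a [] }
  | query a b => { s with arr := Function.update s.arr b (O (s.arr a)) }

/-- The time taken by a basic instruction: one, plus the bit lengths of all numbers involved. -/
def Instr.cost (O : List ℤ → List ℤ) (s : State) : Instr → ℕ
  | const _ c => 1 + bitSize c
  | add _ j k => 1 + bitSize (s.reg j) + bitSize (s.reg k)
  | sub _ j k => 1 + bitSize (s.reg j) + bitSize (s.reg k)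
  | length _ a => 1 + bitSize ((s.arr a).length : ℤ)
  | get _ a j => 1 + bitSize (s.reg j) + bitSize ((s.arr a).getD (s.reg j).toNat 0)
  | put _ j i => 1 + bitSize (s.reg j) + bitSize (s.reg i)
  | push _ i => 1 + bitSize (s.reg i)
  | clear _ => 1
  | query a _ => 1 + listSize (s.arr a) + listSize (O (s.arr a))

/-- Programs: basic instructions, sequential composition, branching on whether register `i` is
positive, and loops that run as long as register `i` is positive. -/
inductive Prog : Type
  | instr (c : Instr) : Prog
  | seq (p q : Prog) : Prog
  | branch (i : ℕ) (p q : Prog) : Prog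
  | loop (i : ℕ) (p : Prog) : Prog

/-- `Exec O p s t s'`: with oracle `O`, the program `p` started in state `s` halts after time `t`
in state `s'`. -/
inductive Exec (O : List ℤ → List ℤ) : Prog → State → ℕ → State → Prop
  | instr (c : Instr) (s : State) :
      Exec O (Prog.instr c) s (c.cost O s) (c.effect O s)
  | seq {p q : Prog} {s s₁ s₂ : State} {t₁ t₂ : ℕ} :
      Exec O p s t₁ s₁ → Exec O q s₁ t₂ s₂ → Exec O (Prog.seq p q) s (t₁ + t₂) s₂
  | branch_pos {i : ℕ} {p q : Prog} {s s₁ : State} {t : ℕ} :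
      0 < s.reg i → Exec O p s t s₁ →
        Exec O (Prog.branch i p q) s (1 + bitSize (s.reg i) + t) s₁
  | branch_nonpos {i : ℕ} {p q : Prog} {s s₁ : State} {t : ℕ} :
      s.reg i ≤ 0 → Exec O q s t s₁ →
        Exec O (Prog.branch i p q) s (1 + bitSize (s.reg i) + t) s₁
  | loop_pos {i : ℕ} {p : Prog} {s s₁ s₂ : State} {t₁ t₂ : ℕ} :
      0 < s.reg i → Exec O p s t₁ s₁ → Exec O (Prog.loop i p) s₁ t₂ s₂ →
        Exec O (Prog.loop i p) s (1 + bitSize (s.reg i) + t₁ + t₂) s₂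
  | loop_nonpos {i : ℕ} {p : Prog} {s : State} :
      s.reg i ≤ 0 → Exec O (Prog.loop i p) s (1 + bitSize (s.reg i)) s

/-- The initial state: the input is in array `0`, and everything else is zero or empty. -/
def initState (x : List ℤ) : State where
  reg _ := 0
  arr a := if a = 0 then x else []

/-- With oracle `O`, the program `p` turns the input `x` into the output `y` (in array `1`) in time
at most `T`. -/
def RunsTo (O : List ℤ → List ℤ) (p : Prog) (x y : List ℤ) (T : ℕ) : Prop :=
  ∃ (t : ℕ) (s : State), Exec O p (initState x) t s ∧ s.arr 1 = y ∧ t ≤ T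

/-! ### Problems and polynomial-time reductions -/

/-- A decision problem. Only the encodings of elements of `Inst` are inputs (so a problem on a
restricted class of inputs is a promise problem). -/
structure DecisionProblem where
  Inst : Type
  encode : Inst → List ℤ
  Yes : Inst → Prop

/-- A function problem: the task is to compute `answer x` from `x`. -/
structure FunctionProblem where
  Inst : Type
  encode : Inst → List ℤ
  answer : Inst → List ℤ

/-- Polynomial-time many-one reducibility: a program without oracle (the oracle that always gives
the empty answer is of no use) computes in polynomial time, from each instance of `A`, an instance
of `B` with the same answer. -/
def ManyOneReducible (A B : DecisionProblem) : Prop :=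
  ∃ (p : Prog) (b : Polynomial ℕ), ∀ x : A.Inst, ∃ y : B.Inst,
    RunsTo (fun _ => []) p (A.encode x) (B.encode y) (b.eval (listSize (A.encode x))) ∧
      (A.Yes x ↔ B.Yes y)

/-- Two decision problems are polynomial-time equivalent. -/
def DecisionEquiv (A B : DecisionProblem) : Prop :=
  ManyOneReducible A B ∧ ManyOneReducible B A

/-- The oracle `O` solves `B`: it answers all instances of `B` correctly; on lists that do not
encode an instance of `B` it may answer anything. -/
def FunctionProblem.SolvedBy (B : FunctionProblem) (O : List ℤ → List ℤ) : Prop :=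
  ∀ y : B.Inst, O (B.encode y) = B.answer y

/-- Polynomial-time (Turing) reducibility: a polynomial-time program solves `A` with the help of
any oracle that solves `B`. -/
def TuringReducible (A B : FunctionProblem) : Prop :=
  ∃ (p : Prog) (b : Polynomial ℕ), ∀ O : List ℤ → List ℤ, B.SolvedBy O →
    ∀ x : A.Inst, RunsTo O p (A.encode x) (A.answer x) (b.eval (listSize (A.encode x)))

/-- Two function problems are polynomial-time equivalent. -/
def FunctionEquiv (A B : FunctionProblem) : Prop :=
  TuringReducible A B ∧ TuringReducible B A

/-- The decision problem of energy games on the class `C` of weighted graphs: given a graph of the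
class and a node `s`, is the minimal energy at `s` finite? -/
def decisionProblem (C : EnergyGame → Prop) : DecisionProblem where
  Inst := {x : (G : EnergyGame) × Fin G.n // C x.1}
  encode x := (x.1.2.val : ℤ) :: x.1.1.encode
  Yes x := x.1.1.minEnergy x.1.2 ≠ ⊤

/-- The value problem of energy games on the class `C` of weighted graphs: given a graph of the
class, compute the minimal energies of all nodes. In the output `-1` stands for infinity. -/
noncomputable def valueProblem (C : EnergyGame → Prop) : FunctionProblem where
  Inst := {G : EnergyGame // C G}
  encode G := G.1.encode
  answer G := (List.finRange G.1.n).map fun s =>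
    if G.1.minEnergy s = ⊤ then -1 else ((G.1.minEnergy s).toNat : ℤ)

/-- The energy game problem (decision version and value version) on arbitrary graphs is
polynomial-time equivalent to the one on the graphs of the class `C`. -/
def AsHardAsGeneral (C : EnergyGame → Prop) : Prop :=
  DecisionEquiv (decisionProblem fun _ => True) (decisionProblem C) ∧
    FunctionEquiv (valueProblem fun _ => True) (valueProblem C)

end EnergyGames

/-! Each of the three classes contains all complete bipartite game graphs, so it suffices to reduce
arbitrary games to complete bipartite ones; in the other direction the input is copied, or passed on
in a single query.

Given `G` and `s`, the game `completion` has a copy of every node for either player. The owner's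
copy of `u` keeps the edges of `u`, directed to the opponent's copies; the other copy of `u` has an
edge of weight 0 to the owner's copy. A play of `G` is thus simulated by alternating moves. The
edges still missing get weights that punish whoever uses them: if `W` bounds all weights and `M > (n
+ 1) W`, Alice loses `M` by a missing edge to Bob's copy of `s` and `3M` by any other, and Bob gives
away `M` or `3M` in the same way. Using such an edge is never better than restarting at `s` with a
deficit. Hence the minimal energy at Alice's copy of `s` is exactly that of `G` at `s`
(`minEnergy_completion`). Nothing is claimed for other nodes, so the value problem is solved with
one completion and one query for every `s`.

The equality rests on potentials: energy `e` suffices at `s` if and only if some set containing `s`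
carries a nonnegative potential, at most `e` at `s`, that Alice can respect and Bob must respect
(`exists_certificate`, `IsCertificate.minEnergy_le`). The potential can be chosen at most `n W`,
which is why `M` outweighs it. Certificates are transported in both directions by
`minEnergy_completion_le` and `minEnergy_le_of_completion`.

For the running time, `Does` counts steps instead of bits: one step lengthens numbers and arrays by
at most one, apart from queries, whose answers are short because finite energies are at most `n W`
(`toNat_minEnergy_le`). The number `M = bigNumber X` is read off the encoding and has polynomially
many bits. -/

namespace EnergyGames

/-! ### Ergodicity of complete bipartite graphs -/

namespace GameGraph

theorem IsCompleteBipartite.adj_iff {V : Type} {G : GameGraph V} (h : G.IsCompleteBipartite)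
    (u v : V) : G.Adj u v ↔ G.alice u ≠ G.alice v :=
  ⟨fun huv heq => h.1 u v heq huv, h.2 u v⟩

theorem IsCompleteBipartite.induce {V : Type} {G : GameGraph V} (h : G.IsCompleteBipartite)
    (U : Set V) : (G.induce U).IsCompleteBipartite :=
  ⟨fun u v => h.1 u v, fun u v => h.2 u v⟩

/-- Were both sides nonempty, staying in one's own side along bipartite edges would put a node of
Bob into `SA` and a node of Alice into `SB`. The edge from the former to the latter is present, but
Bob is confined to `SA`. -/
theorem IsCompleteBipartite.isErgodic {V : Type} {G : GameGraph V} (h : G.IsCompleteBipartite) :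
    G.IsErgodic := by
  intro SA SB hS
  by_contra! hne
  obtain ⟨⟨a, ha⟩, ⟨b, hb⟩⟩ := hne
  have hcov : ∀ x, x ∈ SA ∨ x ∈ SB := fun x => by
    have : x ∈ SA ∪ SB := hS.cover ▸ Set.mem_univ x
    exact this
  have h1 : ∃ x ∈ SA, G.alice x = false := by
    cases hx : G.alice a
    · exact ⟨a, ha, hx⟩
    · obtain ⟨v, hv, hav⟩ := hS.alice_stays a ha hx
      have := (h.adj_iff a v).1 hav
      exact ⟨v, hv, by rw [hx] at this; cases hv : G.alice v <;> simp_all⟩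
  have h2 : ∃ x ∈ SB, G.alice x = true := by
    cases hx : G.alice b
    · obtain ⟨v, hv, hbv⟩ := hS.bob_stays b hb hx
      have := (h.adj_iff b v).1 hbv
      exact ⟨v, hv, by rw [hx] at this; cases hv : G.alice v <;> simp_all⟩
    · exact ⟨b, hb, hx⟩
  obtain ⟨x, hx, hxa⟩ := h1
  obtain ⟨y, hy, hya⟩ := h2
  exact hS.bob_confined x hx hxa y hy ((h.adj_iff x y).2 (by simp [hxa, hya]))

theorem IsCompleteBipartite.isStronglyErgodic {V : Type} {G : GameGraph V}
    (h : G.IsCompleteBipartite) : G.IsStronglyErgodic :=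
  fun U _ => (h.induce U).isErgodic

end GameGraph

/-! ### Clique-width of complete bipartite graphs -/

namespace CliqueExpr

/-- Only `join` creates edges, and it needs two distinct labels. -/
theorem not_adj_of_le_one {k : ℕ} (hk : k ≤ 1) (e : CliqueExpr k) (u v : e.Vert) :
    ¬ e.Adj u v := by
  induction e with
  | node i => exact id
  | union e f he hf =>
    rcases u with u | u <;> rcases v with v | v
    · exact he u v
    · exact id
    · exact id
    · exact hf u v
  | join i j hij e he => exact absurd (Fin.ext (by omega)) hij
  | relabel i j e he => exact he u v

/-- Every labelling of a nonempty edgeless graph is realized by an expression. -/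
theorem exists_edgeless {k : ℕ} (n : ℕ) (lab : Fin (n + 1) → Fin k) :
    ∃ (e : CliqueExpr k) (φ : Fin (n + 1) ≃ e.Vert),
      (∀ u, e.label (φ u) = lab u) ∧ ∀ u v, ¬ e.Adj u v := by
  induction n with
  | zero =>
    refine ⟨node (lab 0), (Equiv.equivPUnit (Fin 1) : Fin 1 ≃ Unit), fun u => ?_, fun _ _ => id⟩
    exact congrArg lab (Subsingleton.elim (α := Fin 1) 0 u)
  | succ n ih =>
    obtain ⟨e, φ, hlab, hadj⟩ := ih fun u => lab u.castSucc
    let ψ : Fin (n + 1 + 1) ≃ e.Vert ⊕ Unit :=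
      finSumFinEquiv.symm.trans (Equiv.sumCongr φ (Equiv.equivPUnit (Fin 1)))
    refine ⟨union e (node (lab (Fin.last _))), ψ, fun u => ?_, ?_⟩
    · refine Fin.lastCases ?_ (fun u => ?_) u
      · have : ψ (Fin.last (n + 1)) = Sum.inr () := by
          have : Fin.last (n + 1) = Fin.natAdd (n + 1) (0 : Fin 1) := rfl
          simp only [ψ, Equiv.trans_apply, this, finSumFinEquiv_symm_apply_natAdd]
          rfl
        exact congrArg (label (union e (node (lab (Fin.last _))))) this
      · have : ψ u.castSucc = Sum.inl (φ u) := by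
          have : u.castSucc = Fin.castAdd 1 u := rfl
          simp only [ψ, Equiv.trans_apply, this, finSumFinEquiv_symm_apply_castAdd]
          rfl
        exact (congrArg (label (union e (node (lab (Fin.last _))))) this).trans (hlab u)
    · rintro (u | u) (v | v)
      · exact hadj u v
      · exact id
      · exact id
      · exact id

end CliqueExpr

namespace EnergyGame

theorem two_le_of_builtWithLabels (G : EnergyGame) {k : ℕ} (h : G.graph.BuiltWithLabels k) :
    2 ≤ k := by
  obtain ⟨e, φ, hφ⟩ := h
  by_contra hk
  obtain ⟨v, hv⟩ := G.outDegree_pos ⟨0, G.n_pos⟩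
  exact e.not_adj_of_le_one (by omega) _ _ ((hφ _ _).1 hv)

theorem builtWithLabels_two (G : EnergyGame) (h : G.graph.IsCompleteBipartite) :
    G.graph.BuiltWithLabels 2 := by
  obtain ⟨e, φ, hlab, hadj⟩ : ∃ (e : CliqueExpr 2) (φ : Fin G.n ≃ e.Vert),
      (∀ u, e.label (φ u) = if G.alice u = true then 1 else 0) ∧ ∀ u v, ¬ e.Adj u v := by
    have key : ∀ (n : ℕ) (lab : Fin n → Fin 2), 0 < n →
        ∃ (e : CliqueExpr 2) (φ : Fin n ≃ e.Vert),
          (∀ u, e.label (φ u) = lab u) ∧ ∀ u v, ¬ e.Adj u v := by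
      intro n lab hn
      cases n with
      | zero => omega
      | succ n => exact CliqueExpr.exists_edgeless n lab
    exact key G.n _ G.n_pos
  -- The label of a node is its owner, so two joins, one in each direction, create exactly the edges
  -- between different players.
  refine ⟨.join 0 1 (by decide) (.join 1 0 (by decide) e), φ, fun u v => ?_⟩
  rw [h.adj_iff]
  change _ ↔ (e.Adj (φ u) (φ v) ∨ (e.label (φ u) = 1 ∧ e.label (φ v) = 0)) ∨
    (e.label (φ u) = 0 ∧ e.label (φ v) = 1)
  have hu : G.graph.alice u = G.alice u := rfl
  have hv : G.graph.alice v = G.alice v := rfl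
  rw [hlab, hlab, hu, hv]
  cases G.alice u <;> cases G.alice v <;> simp [hadj]

theorem cliqueWidth_eq_two (G : EnergyGame) (h : G.graph.IsCompleteBipartite) :
    G.graph.cliqueWidth = 2 := by
  apply le_antisymm
  · exact iInf₂_le 2 (G.builtWithLabels_two h)
  · exact le_iInf₂ fun k hk => by exact_mod_cast G.two_le_of_builtWithLabels hk

end EnergyGame

end EnergyGames

namespace EnergyGames

/-! ### Walks in weighted digraphs -/

/-- The first `m` steps of `x` follow the relation `E`. -/
def IsWalk {V : Type} (E : V → V → Prop) (x : ℕ → V) (m : ℕ) : Prop :=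
  ∀ i < m, E (x i) (x (i + 1))

/-- The total weight of the first `m` steps of `x`. -/
def walkWeight {V : Type} (w : V → V → ℤ) (x : ℕ → V) (m : ℕ) : ℤ :=
  ∑ i ∈ Finset.range m, w (x i) (x (i + 1))

section Walks

variable {V : Type} {E : V → V → Prop} {w : V → V → ℤ}

theorem walkWeight_add (x : ℕ → V) (m k : ℕ) :
    walkWeight w x (m + k) = walkWeight w x m + walkWeight w (fun q => x (m + q)) k := by
  simp only [walkWeight, Finset.sum_range_add]
  rfl

theorem walkWeight_congr {x y : ℕ → V} {m : ℕ} (h : ∀ i ≤ m, x i = y i) :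
    walkWeight w x m = walkWeight w y m := by
  refine Finset.sum_congr rfl fun i hi => ?_
  have := Finset.mem_range.1 hi
  rw [h i (by omega), h (i + 1) (by omega)]

theorem walkWeight_ge {W : ℤ} (hW : ∀ u v, E u v → -W ≤ w u v) {x : ℕ → V} {m : ℕ}
    (hx : IsWalk E x m) : -(m * W) ≤ walkWeight w x m := by
  have := Finset.card_nsmul_le_sum (Finset.range m) (fun i => w (x i) (x (i + 1))) (-W)
    fun i hi => hW _ _ (hx i (Finset.mem_range.1 hi))
  simpa [walkWeight] using this

/-- A closed part of a walk can be cut out. -/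
theorem IsWalk.exists_cut {x : ℕ → V} {i j r : ℕ} (hx : IsWalk E x (j + r)) (hij : i ≤ j)
    (hxij : x i = x j) :
    ∃ y, IsWalk E y (i + r) ∧ y 0 = x 0 ∧ y (i + r) = x (j + r) ∧
      walkWeight w y (i + r) = walkWeight w x (j + r) - (walkWeight w x j - walkWeight w x i) := by
  let y : ℕ → V := fun k => if k ≤ i then x k else x (k - i + j)
  have hle : ∀ k ≤ i, y k = x k := fun k hk => if_pos hk
  have hge : ∀ q, y (i + q) = x (j + q) := fun q => by
    rcases Nat.eq_zero_or_pos q with rfl | hq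
    · simpa [y] using hxij
    · simp only [y]
      rw [if_neg (by omega)]
      congr 1; omega
  refine ⟨y, fun k hk => ?_, hle 0 (Nat.zero_le _), hge r, ?_⟩
  · by_cases hki : k < i
    · rw [hle k hki.le, hle (k + 1) hki]
      exact hx k (by omega)
    · obtain ⟨q, rfl⟩ := Nat.exists_eq_add_of_le (not_lt.1 hki)
      rw [hge q, Nat.add_assoc, hge (q + 1)]
      exact hx (j + q) (by omega)
  · rw [walkWeight_add, walkWeight_add, walkWeight_congr (m := i) hle,
      walkWeight_congr (m := r) fun q _ => hge q]
    ring

theorem IsWalk.exists_append {x : ℕ → V} {m : ℕ} {v : V} (hx : IsWalk E x m) (hv : E (x m) v) :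
    ∃ y, IsWalk E y (m + 1) ∧ y 0 = x 0 ∧ y (m + 1) = v ∧
      walkWeight w y (m + 1) = walkWeight w x m + w (x m) v := by
  let y : ℕ → V := fun k => if k ≤ m then x k else v
  have hle : ∀ k ≤ m, y k = x k := fun k hk => if_pos hk
  have hlast : y (m + 1) = v := if_neg (by omega)
  refine ⟨y, fun i hi => ?_, hle 0 (Nat.zero_le _), hlast, ?_⟩
  · rcases Nat.lt_succ_iff_lt_or_eq.1 hi with hi | rfl
    · rw [hle i hi.le, hle (i + 1) hi]; exact hx i hi
    · rw [hle i le_rfl, hlast]; exact hv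
  · have hsucc : walkWeight w y (m + 1) = walkWeight w y m + w (y m) (y (m + 1)) :=
      Finset.sum_range_succ _ _
    rw [hsucc, hlast, hle m le_rfl, walkWeight_congr (m := m) hle]

theorem exists_walk_of_reflTransGen {s u : V} (h : Relation.ReflTransGen E s u) :
    ∃ x m, IsWalk E x m ∧ x 0 = s ∧ x m = u := by
  induction h with
  | refl => exact ⟨fun _ => s, 0, fun i hi => absurd hi (Nat.not_lt_zero i), rfl, rfl⟩
  | tail _ huv ih =>
    obtain ⟨x, m, hx, hx0, hxm⟩ := ih
    obtain ⟨y, hy, hy0, hym, -⟩ := hx.exists_append (w := fun _ _ => 0) (hxm ▸ huv)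
    exact ⟨y, m + 1, hy, hy0.trans hx0, hym⟩

/-- If closed walks have nonnegative weight, then walks can be shortened without increasing the
weight. -/
theorem IsWalk.exists_short [Fintype V]
    (hE : ∀ x m, IsWalk E x m → x 0 = x m → 0 ≤ walkWeight w x m) :
    ∀ (m : ℕ) (x : ℕ → V), IsWalk E x m → ∃ y k, k ≤ Fintype.card V ∧ IsWalk E y k ∧
      y 0 = x 0 ∧ y k = x m ∧ walkWeight w y k ≤ walkWeight w x m := by
  intro m
  induction m using Nat.strong_induction_on with
  | _ m ih =>
    intro x hx
    by_cases hm : m ≤ Fintype.card V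
    · exact ⟨x, m, hm, hx, rfl, rfl, le_rfl⟩
    obtain ⟨a, b, hab, hxab⟩ : ∃ a b : Fin (m + 1), a ≠ b ∧ x a = x b :=
      Fintype.exists_ne_map_eq_of_card_lt (fun i : Fin (m + 1) => x i) (by simp; omega)
    obtain ⟨i, j, hij, hjm, hxij⟩ : ∃ i j, i < j ∧ j ≤ m ∧ x i = x j := by
      rcases lt_or_gt_of_ne hab with h | h
      · exact ⟨a, b, h, by omega, hxab⟩
      · exact ⟨b, a, h, by omega, hxab.symm⟩
    obtain ⟨r, rfl⟩ := Nat.exists_eq_add_of_le hjm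
    obtain ⟨p, rfl⟩ := Nat.exists_eq_add_of_le hij.le
    obtain ⟨y, hy, hy0, hyr, hyw⟩ := hx.exists_cut (w := w) hij.le hxij
    have hcyc : 0 ≤ walkWeight w (fun q => x (i + q)) p :=
      hE _ _ (fun q hq => hx (i + q) (by omega)) hxij
    obtain ⟨z, k, hk, hz, hz0, hzk, hzw⟩ := ih (i + r) (by omega) y hy
    refine ⟨z, k, hk, hz, hz0.trans hy0, hzk.trans hyr, ?_⟩
    rw [walkWeight_add x i p] at hyw
    linarith

/-- If the walks from `s` have weight at least `-e`, then there is a bounded potential that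
certifies this. -/
theorem exists_potential [Fintype V] {W : ℤ} (hW0 : 0 ≤ W) (hW : ∀ u v, E u v → -W ≤ w u v)
    {s : V} {e : ℕ} (h : ∀ x m, IsWalk E x m → x 0 = s → 0 ≤ e + walkWeight w x m) :
    ∃ (R : Set V) (f : V → ℤ), s ∈ R ∧ (∀ u ∈ R, 0 ≤ f u) ∧
      (∀ u ∈ R, f u ≤ Fintype.card V * W) ∧ f s ≤ e ∧
      ∀ u ∈ R, ∀ v, E u v → v ∈ R ∧ f v ≤ f u + w u v := by
  classical
  let A : V → ℕ → Prop := fun u a =>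
    ∃ x m, IsWalk E x m ∧ x 0 = s ∧ x m = u ∧ (a : ℤ) = e + walkWeight w x m
  let R : Set V := {u | ∃ a, A u a}
  have hs : s ∈ R := ⟨e, fun _ => s, 0, fun i hi => absurd hi (Nat.not_lt_zero i), rfl, rfl,
    by simp [walkWeight]⟩
  have hstep : ∀ u v a, A u a → E u v → ∃ b, A v b ∧ (b : ℤ) = a + w u v := by
    rintro u v a ⟨x, m, hx, hx0, hxm, ha⟩ huv
    obtain ⟨y, hy, hyx, hlast, hyw⟩ := hx.exists_append (w := w) (v := v) (hxm ▸ huv)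
    have hy0 := hyx.trans hx0
    rw [hxm] at hyw
    have hnn := h y (m + 1) hy hy0
    refine ⟨(e + walkWeight w y (m + 1)).toNat, ⟨y, m + 1, hy, hy0, hlast, ?_⟩, ?_⟩
    · exact Int.toNat_of_nonneg hnn
    · rw [Int.toNat_of_nonneg hnn, hyw, ha]; ring
  have hRE : ∀ u ∈ R, ∀ v, E u v → v ∈ R := fun u ⟨a, ha⟩ v huv =>
    let ⟨b, hb, _⟩ := hstep u v a ha huv
    ⟨b, hb⟩
  -- the least energy on arrival
  let g : V → ℕ := fun u => sInf {a | A u a}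
  have hg : ∀ u ∈ R, ∀ v, E u v → (g v : ℤ) ≤ g u + w u v := fun u hu v huv => by
    obtain ⟨b, hb, hbw⟩ := hstep u v (g u) (Nat.sInf_mem hu) huv
    have : g v ≤ b := Nat.sInf_le hb
    rw [← hbw]; exact_mod_cast this
  -- The restriction to `R` matters: outside `R` the set of arrival energies is empty and `g` takes
  -- the default value 0.
  let E' : V → V → Prop := fun u v => u ∈ R ∧ E u v
  have hgw : ∀ (m : ℕ) (x : ℕ → V), IsWalk E' x m → (g (x m) : ℤ) ≤ g (x 0) + walkWeight w x m := by
    intro m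
    induction m with
    | zero => intro x _; simp [walkWeight]
    | succ m ih =>
      intro x hx
      have h1 := ih x fun i hi => hx i (by omega)
      have h2 := hg _ (hx m (Nat.lt_succ_self m)).1 _ (hx m (Nat.lt_succ_self m)).2
      have h3 : walkWeight w x (m + 1) = walkWeight w x m + w (x m) (x (m + 1)) :=
        Finset.sum_range_succ _ _
      linarith
  -- The bound `hgw` telescopes: `g` takes the same value at both ends of a closed walk.
  have hcyc : ∀ x m, IsWalk E' x m → x 0 = x m → 0 ≤ walkWeight w x m := fun x m hx h0 => by
    have := hgw m x hx
    rw [h0] at this; linarith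
  -- the largest loss from here
  let D : V → ℤ → Prop := fun u c => ∃ x m, IsWalk E' x m ∧ x 0 = u ∧ c = -walkWeight w x m
  have hD0 : ∀ u, D u 0 := fun u =>
    ⟨fun _ => u, 0, fun i hi => absurd hi (Nat.not_lt_zero i), rfl, by simp [walkWeight]⟩
  have hDle : ∀ u c, D u c → c ≤ Fintype.card V * W := by
    rintro u c ⟨x, m, hx, -, rfl⟩
    obtain ⟨y, k, hk, hy, -, -, hyw⟩ := IsWalk.exists_short hcyc m x hx
    have h1 := walkWeight_ge (w := w) (fun u v (huv : E' u v) => hW u v huv.2) hy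
    have h2 : (k : ℤ) * W ≤ Fintype.card V * W :=
      mul_le_mul_of_nonneg_right (by exact_mod_cast hk) hW0
    linarith
  have hmax : ∀ u, ∃ c, D u c ∧ ∀ c', D u c' → c' ≤ c := fun u =>
    Int.exists_greatest_of_bdd ⟨_, hDle u⟩ ⟨0, hD0 u⟩
  choose f hf hfmax using hmax
  refine ⟨R, f, hs, fun u _ => hfmax u 0 (hD0 u), fun u _ => hDle u _ (hf u), ?_,
    fun u hu v huv => ⟨hRE u hu v huv, ?_⟩⟩
  · obtain ⟨x, m, hx, hx0, hxw⟩ := hf s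
    have := h x m (fun i hi => (hx i hi).2) hx0
    linarith
  · obtain ⟨x, m, hx, hx0, hxw⟩ := hf v
    -- The worst walk from `v`, preceded by the edge from `u`, competes in the maximum that defines
    -- `f u`.
    let y : ℕ → V := fun k => Nat.casesOn k u x
    have hy : IsWalk E' y (m + 1) := fun i hi => by
      cases i with
      | zero => exact ⟨hu, by change E u (x 0); rwa [hx0]⟩
      | succ i => exact hx i (by omega)
    have hyw : walkWeight w y (m + 1) = walkWeight w x m + w u v := by
      unfold walkWeight
      rw [Finset.sum_range_succ', ← hx0]
      rfl
    have := hfmax u (-walkWeight w y (m + 1)) ⟨y, m + 1, hy, rfl, rfl⟩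
    linarith

end Walks

/-! ### Certificates for minimal energies -/

namespace EnergyGame

/-- The weight of an edge, `0` where there is no edge. -/
def wt (G : EnergyGame) (u v : Fin G.n) : ℤ := (G.weight u v).getD 0

/-- The edges that remain when Alice plays `σ`. -/
def stratAdj (G : EnergyGame) (σ : G.Strategy true) (u v : Fin G.n) : Prop :=
  G.graph.Adj u v ∧ ∀ h : G.alice u = true, v = σ.1 ⟨u, h⟩

/-- The potential `f` on the set `R` certifies that Alice can survive from `s` with energy `e`. -/
structure IsCertificate (G : EnergyGame) (s : Fin G.n) (e : ℕ) (R : Set (Fin G.n))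
    (f : Fin G.n → ℤ) : Prop where
  mem : s ∈ R
  nonneg : ∀ u ∈ R, 0 ≤ f u
  le : f s ≤ e
  alice : ∀ u ∈ R, G.alice u = true → ∃ v, G.graph.Adj u v ∧ v ∈ R ∧ f v ≤ f u + G.wt u v
  bob : ∀ u ∈ R, G.alice u = false → ∀ v, G.graph.Adj u v → v ∈ R ∧ f v ≤ f u + G.wt u v

theorem strategy_nonempty (G : EnergyGame) (b : Bool) : Nonempty (G.Strategy b) :=
  ⟨⟨fun u => (G.outDegree_pos u.1).choose, fun u => (G.outDegree_pos u.1).choose_spec⟩⟩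

theorem pathWeight_eq (G : EnergyGame) (σ : G.Strategy true) (τ : G.Strategy false)
    (s : Fin G.n) (i : ℕ) :
    G.pathWeight σ τ s i = walkWeight G.wt (fun j => (G.next σ τ)^[j] s) i := rfl

theorem playEnergy_le_iff (G : EnergyGame) (σ : G.Strategy true) (τ : G.Strategy false)
    (s : Fin G.n) (e : ℕ) : G.playEnergy σ τ s ≤ e ↔ G.AliceWinsPlay σ τ s e := by
  constructor
  · intro h
    -- Comparing strictly with `e + 1` extracts a witness from the infimum without showing first
    -- that it is attained.
    have hlt : G.playEnergy σ τ s < ((e + 1 : ℕ) : ℕ∞) :=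
      lt_of_le_of_lt h (by exact_mod_cast Nat.lt_succ_self e)
    unfold playEnergy at hlt
    simp only [iInf_lt_iff] at hlt
    obtain ⟨e', hwin, he'⟩ := hlt
    have he' : e' < e + 1 := by exact_mod_cast he'
    intro i
    have := hwin i
    have : (e' : ℤ) ≤ e := by exact_mod_cast Nat.lt_succ_iff.1 he'
    linarith [hwin i]
  · exact fun h => iInf₂_le e h

theorem minEnergy_le_iff (G : EnergyGame) (s : Fin G.n) (e : ℕ) :
    G.minEnergy s ≤ e ↔
      ∃ σ : G.Strategy true, ∀ τ : G.Strategy false, G.AliceWinsPlay σ τ s e := by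
  have : Nonempty (G.Strategy true) := G.strategy_nonempty true
  constructor
  · intro h
    have hlt : G.minEnergy s < ((e + 1 : ℕ) : ℕ∞) :=
      lt_of_le_of_lt h (by exact_mod_cast Nat.lt_succ_self e)
    unfold minEnergy at hlt
    obtain ⟨σ, hσ⟩ := iInf_lt_iff.1 hlt
    refine ⟨σ, fun τ => (G.playEnergy_le_iff σ τ s e).1 ?_⟩
    have := lt_of_le_of_lt (le_iSup (fun τ => G.playEnergy σ τ s) τ) hσ
    exact Order.le_of_lt_add_one (by exact_mod_cast this)
  · rintro ⟨σ, hσ⟩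
    exact (iInf_le _ σ).trans (iSup_le fun τ => (G.playEnergy_le_iff σ τ s e).2 (hσ τ))

/-- A walk without repetitions (except possibly at its end) is played by some strategy of Bob. -/
theorem exists_strategy_of_walk (G : EnergyGame) (σ : G.Strategy true) {x : ℕ → Fin G.n} {m : ℕ}
    (hx : IsWalk (G.stratAdj σ) x m) (hinj : ∀ i < m, ∀ j < m, x i = x j → i = j) :
    ∃ τ : G.Strategy false, ∀ i ≤ m, (G.next σ τ)^[i] (x 0) = x i := by
  classical
  have hex : ∀ u : {u : Fin G.n // G.alice u = false},
      ∃ v, G.graph.Adj u.1 v ∧ ∀ i < m, x i = u.1 → v = x (i + 1) := by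
    intro u
    by_cases h : ∃ i < m, x i = u.1
    · obtain ⟨i, hi, hiu⟩ := h
      exact ⟨x (i + 1), hiu ▸ (hx i hi).1,
        fun j hj hju => by rw [hinj i hi j hj (hiu.trans hju.symm)]⟩
    · push Not at h
      obtain ⟨v, hv⟩ := G.outDegree_pos u.1
      exact ⟨v, hv, fun i hi hiu => absurd hiu (h i hi)⟩
  choose τ hτ hτx using hex
  refine ⟨⟨τ, hτ⟩, fun i => ?_⟩
  induction i with
  | zero => intro _; rfl
  | succ i ih =>
    intro hi
    rw [Function.iterate_succ_apply', ih (by omega)]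
    unfold next
    split
    · rename_i ha
      exact ((hx i hi).2 ha).symm
    · exact hτx _ i hi rfl

/-- Bob can do as well with positional strategies as with arbitrary walks. -/
theorem walk_nonneg_of_wins (G : EnergyGame) (σ : G.Strategy true) {s : Fin G.n} {e : ℕ}
    (h : ∀ τ : G.Strategy false, G.AliceWinsPlay σ τ s e) :
    ∀ (m : ℕ) (x : ℕ → Fin G.n), IsWalk (G.stratAdj σ) x m → x 0 = s →
      0 ≤ e + walkWeight G.wt x m := by
  classical
  intro m
  induction m using Nat.strong_induction_on with
  | _ m ih =>
    intro x hx hx0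
    by_cases hrep : ∃ j, j < m ∧ ∃ i < j, x i = x j
    · have hj := Nat.find_spec hrep
      have hjmin : ∀ k, k < Nat.find hrep → ¬ (k < m ∧ ∃ i < k, x i = x k) :=
        fun k hk => Nat.find_min hrep hk
      generalize Nat.find hrep = j at hj hjmin
      obtain ⟨hjm, i, hij, hxij⟩ := hj
      have hinj : ∀ a < j, ∀ b < j, x a = x b → a = b := by
        intro a ha b hb hab
        rcases lt_trichotomy a b with hlt | heq | hlt
        · exact absurd ⟨by omega, a, hlt, hab⟩ (hjmin b hb)
        · exact heq
        · exact absurd ⟨by omega, b, hlt, hab.symm⟩ (hjmin a ha)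
      -- Up to its first repetition the walk is played by a positional strategy, and this strategy
      -- then goes round the cycle between `i` and `j` for ever. So the cycle cannot lose energy,
      -- and cutting it out leaves a shorter walk of no larger weight.
      obtain ⟨τ, hτ⟩ := G.exists_strategy_of_walk σ (m := j)
        (fun q hq => hx q (by omega)) hinj
      rw [hx0] at hτ
      have hwin := h τ
      obtain ⟨p, rfl⟩ := Nat.exists_eq_add_of_le hij.le
      set y : ℕ → Fin G.n := fun q => (G.next σ τ)^[q] s with hy
      have hyx : ∀ q ≤ i + p, y q = x q := hτ
      have hper : ∀ a q, y a = y i → y (a + q) = y (i + q) := by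
        intro a q ha
        simp only [hy] at ha ⊢
        rw [Nat.add_comm, Function.iterate_add_apply, ha, ← Function.iterate_add_apply,
          Nat.add_comm]
      have hip : y (i + p) = y i := by rw [hyx _ le_rfl, hyx i (by omega), hxij]
      have hpump : ∀ q : ℕ, y (i + q * p) = y i ∧ walkWeight G.wt y (i + q * p) =
          walkWeight G.wt y i + q * walkWeight G.wt (fun r => y (i + r)) p := by
        intro q
        induction q with
        | zero => simp
        | succ q ihq =>
          have hsplit : i + (q + 1) * p = (i + q * p) + p := by ring
          refine ⟨by rw [hsplit, hper _ p ihq.1, hip], ?_⟩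
          rw [hsplit, walkWeight_add, ihq.2,
            walkWeight_congr (y := fun r => y (i + r)) fun r _ => hper _ r ihq.1]
          push_cast; ring
      have hcyc : 0 ≤ walkWeight G.wt (fun r => y (i + r)) p := by
        by_contra hneg
        have h0 := hwin i
        rw [pathWeight_eq] at h0
        -- A cycle of negative weight loses at least 1 per lap, so this number of laps brings the
        -- energy below zero.
        have h1 := hwin (i + (e + walkWeight G.wt y i + 1).toNat * p)
        rw [pathWeight_eq, (hpump _).2, Int.toNat_of_nonneg (by linarith)] at h1
        nlinarith
      obtain ⟨r, rfl⟩ := Nat.exists_eq_add_of_le hjm.le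
      obtain ⟨z, hz, hz0, -, hzw⟩ := hx.exists_cut (w := G.wt) (Nat.le_add_right i p) hxij
      have := ih (i + r) (by omega) z hz (hz0.trans hx0)
      rw [hzw, walkWeight_add x i p,
        ← walkWeight_congr (x := fun r => y (i + r)) (y := fun q => x (i + q)) (m := p)
          fun q hq => hyx (i + q) (by omega)] at this
      linarith
    · push Not at hrep
      have hinj : ∀ a < m, ∀ b < m, x a = x b → a = b := by
        intro a ha b hb hab
        rcases lt_trichotomy a b with hlt | heq | hlt
        · exact absurd hab (hrep b hb a hlt)
        · exact heq
        · exact absurd hab.symm (hrep a ha b hlt)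
      obtain ⟨τ, hτ⟩ := G.exists_strategy_of_walk σ hx hinj
      have := h τ m
      rw [pathWeight_eq, ← hx0] at this
      rwa [walkWeight_congr (m := m) hτ] at this

/-- Alice follows the edges that the certificate promises. The play stays in `R`, and the energy
minus the potential never decreases, so the energy stays above a nonnegative potential. -/
theorem IsCertificate.minEnergy_le {G : EnergyGame} {s : Fin G.n} {e : ℕ} {R : Set (Fin G.n)}
    {f : Fin G.n → ℤ} (h : G.IsCertificate s e R f) : G.minEnergy s ≤ e := by
  classical
  rw [minEnergy_le_iff]
  have hex : ∀ u : {u : Fin G.n // G.alice u = true}, ∃ v, G.graph.Adj u.1 v ∧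
      (u.1 ∈ R → v ∈ R ∧ f v ≤ f u.1 + G.wt u.1 v) := by
    intro u
    by_cases hu : u.1 ∈ R
    · obtain ⟨v, hv⟩ := h.alice u.1 hu u.2
      exact ⟨v, hv.1, fun _ => hv.2⟩
    · obtain ⟨v, hv⟩ := G.outDegree_pos u.1
      exact ⟨v, hv, fun hu' => absurd hu' hu⟩
  choose σ hσ hσR using hex
  refine ⟨⟨σ, hσ⟩, fun τ => ?_⟩
  have hstep : ∀ u ∈ R, G.next ⟨σ, hσ⟩ τ u ∈ R ∧
      f (G.next ⟨σ, hσ⟩ τ u) ≤ f u + G.wt u (G.next ⟨σ, hσ⟩ τ u) := by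
    intro u hu
    unfold next
    split
    · exact hσR _ hu
    · rename_i ha
      exact h.bob u hu (Bool.eq_false_iff.2 ha) _ (τ.2 ⟨u, _⟩)
  have hall : ∀ i, (G.next ⟨σ, hσ⟩ τ)^[i] s ∈ R ∧
      f ((G.next ⟨σ, hσ⟩ τ)^[i] s) ≤ f s + G.pathWeight ⟨σ, hσ⟩ τ s i := by
    intro i
    induction i with
    | zero => simpa [pathWeight] using h.mem
    | succ i ih =>
      have h1 := hstep _ ih.1
      have h2 : G.pathWeight ⟨σ, hσ⟩ τ s (i + 1) = G.pathWeight ⟨σ, hσ⟩ τ s i +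
          G.wt ((G.next ⟨σ, hσ⟩ τ)^[i] s) (G.next ⟨σ, hσ⟩ τ ((G.next ⟨σ, hσ⟩ τ)^[i] s)) := by
        rw [← Function.iterate_succ_apply' (G.next ⟨σ, hσ⟩ τ)]
        exact Finset.sum_range_succ _ _
      rw [Function.iterate_succ_apply']
      exact ⟨h1.1, by linarith [h1.2, ih.2]⟩
  intro i
  linarith [h.nonneg _ (hall i).1, (hall i).2, h.le]

/-- A good strategy `σ` leaves a graph in which only Bob moves. By `walk_nonneg_of_wins` all its
walks from `s` are harmless, so `exists_potential` applies there. The bound on `f` is what the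
weight `M` of the completion has to exceed. -/
theorem exists_certificate {G : EnergyGame} {s : Fin G.n} {e : ℕ} (h : G.minEnergy s ≤ e)
    {W : ℤ} (hW0 : 0 ≤ W) (hW : ∀ u v, -W ≤ G.wt u v) :
    ∃ R f, G.IsCertificate s e R f ∧ ∀ u ∈ R, f u ≤ G.n * W := by
  obtain ⟨σ, hσ⟩ := (G.minEnergy_le_iff s e).1 h
  obtain ⟨R, f, hs, hnn, hle, hse, hE⟩ := exists_potential hW0 (fun u v _ => hW u v)
    fun x m => G.walk_nonneg_of_wins σ hσ m x
  refine ⟨R, f, ⟨hs, hnn, hse, fun u hu ha => ?_, fun u hu ha v huv => ?_⟩, by simpa using hle⟩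
  · have hadj := σ.2 ⟨u, ha⟩
    exact ⟨_, hadj, hE u hu _ ⟨hadj, fun _ => rfl⟩⟩
  · exact hE u hu v ⟨huv, fun h => by simp [ha] at h⟩

/-- A finite minimal energy is at most the number of nodes times the largest loss on an edge. -/
theorem toNat_minEnergy_le (G : EnergyGame) (s : Fin G.n) {W : ℕ}
    (hW : ∀ u v, -(W : ℤ) ≤ G.wt u v) : (G.minEnergy s).toNat ≤ G.n * W := by
  by_cases htop : G.minEnergy s = ⊤
  · simp [htop]
  obtain ⟨e, he⟩ := ENat.ne_top_iff_exists.1 htop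
  obtain ⟨R, f, hc, hb⟩ := exists_certificate (e := e) he.symm.le (Int.natCast_nonneg W) hW
  have hf0 := hc.nonneg s hc.mem
  have hc' : G.IsCertificate s (f s).toNat R f :=
    ⟨hc.mem, hc.nonneg, by rw [Int.toNat_of_nonneg hf0], hc.alice, hc.bob⟩
  have h1 := ENat.toNat_le_toNat hc'.minEnergy_le (ENat.natCast_ne_top _)
  have h2 := hb s hc.mem
  simp only [ENat.toNat_natCast] at h1
  zify
  zify at h1
  rw [Int.toNat_of_nonneg hf0] at h1
  linarith

end EnergyGame

end EnergyGames

namespace EnergyGames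

namespace EnergyGame

/-! ### The completion of a game -/

/-- The edges that leave the copy of `u` owned by player `b`: those of `u` if `b` owns `u`, and
otherwise only the edge to the other copy of `u`. -/
def copyWeight (G : EnergyGame) (b : Bool) (u v : Fin G.n) : Option ℤ :=
  if G.alice u = b then G.weight u v else if u = v then some 0 else none

/-- The weights of the completed graph: the missing edges get weight `res` if they lead to the
copy of `s`, and `bad` otherwise. -/
def fillWeight (G : EnergyGame) (s : Fin G.n) (b : Bool) (res bad : ℤ) (u v : Fin G.n) : ℤ :=
  (G.copyWeight b u v).getD (if v = s then res else bad)

/-- The complete bipartite game with a copy of every node for either player. -/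
def completion (G : EnergyGame) (s : Fin G.n) (M : ℤ) : EnergyGame where
  n := G.n + G.n
  n_pos := Nat.add_pos_left G.n_pos _
  alice := Fin.append (fun _ => true) (fun _ => false)
  weight := Fin.append
    (fun u => Fin.append (fun _ => none)
      (fun v => some (G.fillWeight s true (-M) (-(M + M + M)) u v)))
    (fun u => Fin.append (fun v => some (G.fillWeight s false M (M + M + M) u v)) (fun _ => none))
  outDegree_pos u := by
    refine Fin.addCases (fun u => ⟨Fin.natAdd _ u, ?_⟩) (fun u => ⟨Fin.castAdd _ u, ?_⟩) u <;>
      simp only [Fin.append_left, Fin.append_right, Option.isSome_some]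

variable (G : EnergyGame) (s : Fin G.n) (M : ℤ)

/-- Alice's copy of a node. -/
def aliceCopy (u : Fin G.n) : Fin (G.completion s M).n := Fin.castAdd G.n u

/-- Bob's copy of a node. -/
def bobCopy (u : Fin G.n) : Fin (G.completion s M).n := Fin.natAdd G.n u

theorem copy_cases (x : Fin (G.completion s M).n) :
    (∃ u, x = G.aliceCopy s M u) ∨ ∃ u, x = G.bobCopy s M u :=
  Fin.addCases (motive := fun x => (∃ u, x = G.aliceCopy s M u) ∨ ∃ u, x = G.bobCopy s M u)
    (fun u => Or.inl ⟨u, rfl⟩) (fun u => Or.inr ⟨u, rfl⟩) x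

@[simp] theorem alice_aliceCopy (u : Fin G.n) :
    (G.completion s M).alice (G.aliceCopy s M u) = true := by
  simp only [completion, aliceCopy, Fin.append_left]

@[simp] theorem alice_bobCopy (u : Fin G.n) :
    (G.completion s M).alice (G.bobCopy s M u) = false := by
  simp only [completion, bobCopy, Fin.append_right]

@[simp] theorem weight_aliceCopy_aliceCopy (u v : Fin G.n) :
    (G.completion s M).weight (G.aliceCopy s M u) (G.aliceCopy s M v) = none := by
  simp only [completion, aliceCopy, Fin.append_left]

@[simp] theorem weight_aliceCopy_bobCopy (u v : Fin G.n) :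
    (G.completion s M).weight (G.aliceCopy s M u) (G.bobCopy s M v) =
      some (G.fillWeight s true (-M) (-(M + M + M)) u v) := by
  simp only [completion, aliceCopy, bobCopy, Fin.append_left, Fin.append_right]

@[simp] theorem weight_bobCopy_aliceCopy (u v : Fin G.n) :
    (G.completion s M).weight (G.bobCopy s M u) (G.aliceCopy s M v) =
      some (G.fillWeight s false M (M + M + M) u v) := by
  simp only [completion, aliceCopy, bobCopy, Fin.append_left, Fin.append_right]

@[simp] theorem weight_bobCopy_bobCopy (u v : Fin G.n) :
    (G.completion s M).weight (G.bobCopy s M u) (G.bobCopy s M v) = none := by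
  simp only [completion, bobCopy, Fin.append_right]

theorem completion_isCompleteBipartite : (G.completion s M).graph.IsCompleteBipartite := by
  constructor <;> intro x y <;>
  · rcases G.copy_cases s M x with ⟨u, rfl⟩ | ⟨u, rfl⟩ <;>
      rcases G.copy_cases s M y with ⟨v, rfl⟩ | ⟨v, rfl⟩ <;> simp [graph]

variable {G s M}

theorem copyWeight_bound {W : ℤ} (hW : ∀ u v, |G.wt u v| ≤ W) {b : Bool} {u v : Fin G.n}
    {c : ℤ} (h : G.copyWeight b u v = some c) : |c| ≤ W := by
  have hu := hW u v
  unfold copyWeight at h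
  split at h
  · simpa [wt, h] using hu
  · split at h
    · obtain rfl : 0 = c := by simpa using h
      simpa using (abs_nonneg _).trans hu
    · simp at h

/-- A certificate of `G` is put on both copies of the nodes in `R` and extended to all nodes. Off
`R`, Alice restarts at `s`; Bob's missing edges give her enough energy to be anywhere. -/
theorem minEnergy_completion_le {W : ℤ} (hW : ∀ u v, |G.wt u v| ≤ W)
    (hM : (G.n + 1) * W < M) {e : ℕ} (h : G.minEnergy s ≤ e) :
    (G.completion s M).minEnergy (G.aliceCopy s M s) ≤ e := by
  classical
  have hW0 : 0 ≤ W := (abs_nonneg _).trans (hW s s)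
  have hn : (0 : ℤ) < G.n := by exact_mod_cast G.n_pos
  have hWM : W ≤ M := by nlinarith
  obtain ⟨R, f, hc, hb⟩ := exists_certificate h hW0 fun u v => (abs_le.1 (hW u v)).1
  have hfs := hc.nonneg s hc.mem
  -- Off `R`, Alice's copy holds enough to pay `M` and arrive at `s` with `f s`; Bob's copy holds
  -- `W` more, enough to absorb one edge that is not missing.
  let fA : Fin G.n → ℤ := fun u => if u ∈ R then f u else f s + M
  let fB : Fin G.n → ℤ := fun u => if u ∈ R then f u else f s + M + W
  let F : Fin (G.completion s M).n → ℤ := Fin.append fA fB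
  have hFA : ∀ u, F (G.aliceCopy s M u) = fA u := Fin.append_left _ _
  have hFB : ∀ u, F (G.bobCopy s M u) = fB u := Fin.append_right _ _
  have hfA0 : ∀ u, 0 ≤ fA u := fun u => by
    simp only [fA]; split
    · exact hc.nonneg u ‹_›
    · linarith
  have hfB0 : ∀ u, 0 ≤ fB u := fun u => by
    simp only [fB]; split
    · exact hc.nonneg u ‹_›
    · linarith
  have hfAle : ∀ u, fA u ≤ f s + M := fun u => by
    simp only [fA]; split
    · have := hb u ‹_›; nlinarith
    · exact le_rfl
  have hfBs : fB s = f s := if_pos hc.mem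
  have hfAs : fA s = f s := if_pos hc.mem
  refine IsCertificate.minEnergy_le (R := Set.univ) (f := F) ⟨Set.mem_univ _, ?_, ?_, ?_, ?_⟩
  · intro x _
    rcases G.copy_cases s M x with ⟨u, rfl⟩ | ⟨u, rfl⟩
    · rw [hFA]; exact hfA0 u
    · rw [hFB]; exact hfB0 u
  · rw [hFA, hfAs]; exact hc.le
  · intro x _ hx
    rcases G.copy_cases s M x with ⟨u, rfl⟩ | ⟨u, rfl⟩
    swap
    · simp at hx
    suffices hs : ∃ v, fB v ≤ fA u + G.fillWeight s true (-M) (-(M + M + M)) u v by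
      obtain ⟨v, hv⟩ := hs
      refine ⟨G.bobCopy s M v, by simp [graph], Set.mem_univ _, ?_⟩
      rw [hFA, hFB]; simpa [wt] using hv
    by_cases hu : u ∈ R
    · have hfAu : fA u = f u := if_pos hu
      cases ha : G.alice u
      · refine ⟨u, ?_⟩
        rw [hfAu]
        simp [fB, hu, fillWeight, copyWeight, ha]
      · obtain ⟨v, hadj, hv, hfv⟩ := hc.alice u hu ha
        refine ⟨v, ?_⟩
        obtain ⟨c, hcw⟩ := Option.isSome_iff_exists.1 hadj
        rw [hfAu]
        simpa [fB, hv, fillWeight, copyWeight, ha, hcw, wt] using hfv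
    -- The edge to Bob's copy of `s` costs exactly `M` if it was missing, and at most `W ≤ M`
    -- otherwise.
    · refine ⟨s, ?_⟩
      have hfAu : fA u = f s + M := if_neg hu
      rw [hfAu, hfBs]
      unfold fillWeight
      cases hcw : G.copyWeight true u s with
      | none => simp
      | some c =>
        have := (abs_le.1 (copyWeight_bound hW hcw)).1
        simp only [Option.getD_some]
        linarith
  · intro x _ hx y hadj
    rcases G.copy_cases s M x with ⟨u, rfl⟩ | ⟨u, rfl⟩
    · simp at hx
    rcases G.copy_cases s M y with ⟨v, rfl⟩ | ⟨v, rfl⟩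
    swap
    · simp [graph] at hadj
    refine ⟨Set.mem_univ _, ?_⟩
    rw [hFA, hFB]
    suffices hs : fA v ≤ fB u + G.fillWeight s false M (M + M + M) u v by simpa [wt] using hs
    have hAv := hfAle v
    have hBu := hfB0 u
    unfold fillWeight
    cases hcw : G.copyWeight false u v with
    | none =>
      simp only [Option.getD_none]
      by_cases hv : v = s
      · rw [if_pos hv, hv, hfAs]
        simp only [fB]; split
        · have := hb s hc.mem
          have := hc.nonneg u ‹_›
          nlinarith
        · linarith
      · rw [if_neg hv]
        have := hb s hc.mem
        nlinarith
    | some c =>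
      simp only [Option.getD_some]
      have hcb := (abs_le.1 (copyWeight_bound hW hcw)).1
      by_cases hu : u ∈ R
      · have hfBu : fB u = f u := if_pos hu
        rw [hfBu]
        unfold copyWeight at hcw
        split at hcw
        · have := hc.bob u hu ‹_› v (by simp [graph, hcw])
          simp only [fA, if_pos this.1]
          simpa [wt, hcw] using this.2
        · split at hcw
          · obtain rfl : 0 = c := by simpa using hcw
            obtain rfl : u = v := ‹_›
            simp [fA, hu]
          · simp at hcw
      · have hfBu : fB u = f s + M + W := if_neg hu
        linarith

/-- The potential on the owners' copies certifies `G`, restricted to the nodes reachable from `s`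
along edges that respect it. There the potential exceeds that of `s` by at most `n W`, too little
for Alice's certified moves to use missing edges. Bob's missing edges play a role only through his
option of moving to Alice's copy of `s`. -/
theorem minEnergy_le_of_completion {W : ℤ} (hW : ∀ u v, |G.wt u v| ≤ W)
    (hM : (G.n + 1) * W < M) {e : ℕ}
    (h : (G.completion s M).minEnergy (G.aliceCopy s M s) ≤ e) : G.minEnergy s ≤ e := by
  classical
  have hW0 : 0 ≤ W := (abs_nonneg _).trans (hW s s)
  have hn : (0 : ℤ) < G.n := by exact_mod_cast G.n_pos
  have hWM : W ≤ M := by nlinarith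
  have hM0 : 0 < M := by nlinarith
  obtain ⟨R, f, hc, -⟩ := exists_certificate h
    -- Any bound on the weights will do, as the resulting bound on the potential is discarded.
    (W := ∑ x, ∑ y, |(G.completion s M).wt x y|)
    (Finset.sum_nonneg fun x _ => Finset.sum_nonneg fun y _ => abs_nonneg _)
    (fun u v => by
      have h1 := Finset.single_le_sum (f := fun y => |(G.completion s M).wt u y|)
        (fun y _ => abs_nonneg _) (Finset.mem_univ v)
      have h2 := Finset.single_le_sum (f := fun x => ∑ y, |(G.completion s M).wt x y|)
        (fun x _ => Finset.sum_nonneg fun y _ => abs_nonneg _) (Finset.mem_univ u)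
      have := neg_abs_le ((G.completion s M).wt u v)
      linarith)
  obtain ⟨fA, hfA⟩ : ∃ fA : Fin G.n → ℤ, ∀ u, f (G.aliceCopy s M u) = fA u := ⟨_, fun _ => rfl⟩
  obtain ⟨fB, hfB⟩ : ∃ fB : Fin G.n → ℤ, ∀ u, f (G.bobCopy s M u) = fB u := ⟨_, fun _ => rfl⟩
  obtain ⟨RA, hRA⟩ : ∃ RA : Fin G.n → Prop, ∀ u, G.aliceCopy s M u ∈ R ↔ RA u :=
    ⟨_, fun _ => Iff.rfl⟩
  obtain ⟨RB, hRB⟩ : ∃ RB : Fin G.n → Prop, ∀ u, G.bobCopy s M u ∈ R ↔ RB u :=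
    ⟨_, fun _ => Iff.rfl⟩
  have hAs : RA s := (hRA s).1 hc.mem
  have hA0 : ∀ u, RA u → 0 ≤ fA u := fun u hu => by
    rw [← hfA]; exact hc.nonneg _ ((hRA u).2 hu)
  have hB0 : ∀ u, RB u → 0 ≤ fB u := fun u hu => by
    rw [← hfB]; exact hc.nonneg _ ((hRB u).2 hu)
  have hA : ∀ u, RA u → ∃ v, RB v ∧ fB v ≤ fA u + G.fillWeight s true (-M) (-(M + M + M)) u v := by
    intro u hu
    obtain ⟨y, hadj, hy, hle⟩ := hc.alice _ ((hRA u).2 hu) (by simp)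
    rcases G.copy_cases s M y with ⟨v, rfl⟩ | ⟨v, rfl⟩
    · simp [graph] at hadj
    · refine ⟨v, (hRB v).1 hy, ?_⟩
      rw [hfA, hfB] at hle
      simpa [wt] using hle
  have hB : ∀ u v, RB u → RA v ∧ fA v ≤ fB u + G.fillWeight s false M (M + M + M) u v := by
    intro u v hu
    obtain ⟨hy, hle⟩ := hc.bob _ ((hRB u).2 hu) (by simp) (G.aliceCopy s M v) (by simp [graph])
    refine ⟨(hRA v).1 hy, ?_⟩
    rw [hfA, hfB] at hle
    simpa [wt] using hle
  -- From any of his copies Bob can return to Alice's copy of `s`, giving away at most `M`.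
  have hBs : ∀ u, RB u → fA s ≤ fB u + M := by
    intro u hu
    refine (hB u s hu).2.trans (add_le_add_right ?_ _)
    unfold fillWeight
    cases hcw : G.copyWeight false u s with
    | none => simp
    | some c =>
      have := (abs_le.1 (copyWeight_bound hW hcw)).2
      simp only [Option.getD_some]
      linarith
  -- the potential on the copy that belongs to the owner of the node
  let r : Fin G.n → ℤ := fun u => if G.alice u = true then fA u else fB u
  let Q : Fin G.n → Prop := fun u => if G.alice u = true then RA u else RB u
  -- If Bob owns `s`, Alice must leave her copy of `s` by the edge of weight 0: any other move costs
  -- `3M`, while Bob's return to `s` refunds at most `M`. If Alice owns `s`, the edge of weight 0 is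
  -- one of Bob's moves.
  have hstart : Q s ∧ r s ≤ fA s ∧ (RB s → r s ≤ fB s) := by
    cases ha : G.alice s
    · simp only [Q, r, ha]
      obtain ⟨v, hv, hle⟩ := hA s hAs
      have hvs : v = s := by
        by_contra hne
        have := hBs v hv
        rw [fillWeight, copyWeight, if_neg (by simp [ha]), if_neg (Ne.symm hne),
          Option.getD_none, if_neg hne] at hle
        linarith
      subst hvs
      simp only [fillWeight, copyWeight, ha, Bool.false_eq_true, if_false, if_true,
        Option.getD_some, add_zero] at hle
      simpa using ⟨hv, hle⟩
    · simp only [Q, r, ha, if_true]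
      refine ⟨hAs, le_rfl, fun hs => ?_⟩
      simpa [fillWeight, copyWeight, ha] using (hB s s hs).2
  obtain ⟨hQs, hrs, hrs'⟩ := hstart
  -- A missing edge to `s` would arrive with less than `r s`. A missing edge elsewhere costs `3M`,
  -- and after Bob's return to `s`, worth at most `M`, the potential there would again be below `r
  -- s`.
  have hgood : ∀ u, RA u → fA u ≤ r s + (G.n + 1) * W →
      ∃ v c, RB v ∧ G.copyWeight true u v = some c ∧ fB v ≤ fA u + c := by
    intro u hu hle
    obtain ⟨v, hv, hfv⟩ := hA u hu
    unfold fillWeight at hfv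
    cases hcw : G.copyWeight true u v with
    | some c => exact ⟨v, c, hv, hcw, by simpa [hcw] using hfv⟩
    | none =>
      exfalso
      rw [hcw, Option.getD_none] at hfv
      by_cases hvs : v = s
      · rw [if_pos hvs] at hfv
        have := hrs' (hvs ▸ hv)
        rw [hvs] at hfv
        linarith
      · rw [if_neg hvs] at hfv
        have := hBs v hv
        linarith
  let D : Fin G.n → Fin G.n → Prop := fun u v =>
    G.graph.Adj u v ∧ Q v ∧ r v ≤ r u + G.wt u v
  have hDr : ∀ (m : ℕ) (x : ℕ → Fin G.n), IsWalk D x m → r (x m) ≤ r (x 0) + m * W := by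
    intro m
    induction m with
    | zero => intro x _; simp
    | succ m ih =>
      intro x hx
      have h1 := ih x fun i hi => hx i (by omega)
      have h2 := (hx m (Nat.lt_succ_self m)).2.2
      have h3 := (abs_le.1 (hW (x m) (x (m + 1)))).2
      push_cast
      linarith
  have hreach : ∀ u, Relation.ReflTransGen D s u → Q u ∧ r u ≤ r s + G.n * W := by
    intro u hu
    refine ⟨?_, ?_⟩
    · rcases Relation.ReflTransGen.cases_tail hu with rfl | ⟨v, -, hv⟩
      · exact hQs
      · exact hv.2.1
    · obtain ⟨x, m, hx, hx0, hxm⟩ := exists_walk_of_reflTransGen hu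
      -- With zero weights the shortening lemma only bounds the number of edges, by `G.n`.
      obtain ⟨y, k, hk, hy, hy0, hyk, -⟩ := IsWalk.exists_short (w := fun _ _ => 0)
        (fun x m _ _ => by simp [walkWeight]) m x hx
      have := hDr k y hy
      rw [hyk, hy0, hx0, hxm] at this
      have hk' : (k : ℤ) * W ≤ G.n * W :=
        mul_le_mul_of_nonneg_right (by exact_mod_cast (by simpa using hk)) hW0
      linarith
  refine IsCertificate.minEnergy_le (R := {u | Relation.ReflTransGen D s u}) (f := r)
    ⟨Relation.ReflTransGen.refl, ?_, ?_, ?_, ?_⟩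
  · intro u hu
    have := (hreach u hu).1
    simp only [Q, r] at this ⊢
    split at this
    · rw [if_pos ‹_›]; exact hA0 u this
    · rw [if_neg ‹_›]; exact hB0 u this
  · have := hc.le
    rw [hfA] at this
    exact hrs.trans this
  · intro u hu ha
    obtain ⟨hQu, hru⟩ := hreach u hu
    simp only [Q, r, ha, if_true] at hQu hru
    obtain ⟨v, c, hv, hcw, hle⟩ := hgood u hQu (by linarith)
    simp only [copyWeight, ha, if_true] at hcw
    have hwt : G.wt u v = c := by simp [wt, hcw]
    have hadj : G.graph.Adj u v := by simp [graph, hcw]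
    have hD : D u v := by
      refine ⟨hadj, ?_⟩
      rw [hwt]
      simp only [Q, r, ha, if_true]
      -- The edge ends at Bob's copy of `v`. If Alice owns `v`, Bob's edge of weight 0 leads on to
      -- her copy.
      cases hav : G.alice v
      · simpa using ⟨hv, hle⟩
      · have := hB v v hv
        simp only [fillWeight, copyWeight, hav, Bool.true_eq_false, if_false, if_true,
          Option.getD_some, add_zero] at this
        simpa using ⟨this.1, this.2.trans hle⟩
    exact ⟨v, hadj, Relation.ReflTransGen.tail hu hD, hD.2.2⟩
  · intro u hu ha v hadj
    obtain ⟨hQu, hru⟩ := hreach u hu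
    simp only [Q, r, ha, Bool.false_eq_true, if_false] at hQu hru
    obtain ⟨c, hcw⟩ := Option.isSome_iff_exists.1 hadj
    have hwt : G.wt u v = c := by simp [wt, hcw]
    have hD : D u v := by
      refine ⟨hadj, ?_⟩
      rw [hwt]
      obtain ⟨hv, hle⟩ := hB u v hQu
      simp only [fillWeight, copyWeight, ha, if_true, hcw, Option.getD_some] at hle
      have hcW := (abs_le.1 (hW u v)).2
      rw [hwt] at hcW
      simp only [Q, r, ha, Bool.false_eq_true, if_false]
      -- The edge ends at Alice's copy of `v`. If Bob owns `v`, `hgood` forces her to move on along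
      -- the edge of weight 0. This intermediate copy is one edge beyond the bound `r s + n W`,
      -- hence `n + 1` in the choice of `M`.
      cases hav : G.alice v
      · obtain ⟨y, c', hy, hcw', hle'⟩ := hgood v hv (by linarith)
        simp only [copyWeight, hav, Bool.false_eq_true, if_false] at hcw'
        split at hcw'
        · rename_i hvy
          subst hvy
          obtain rfl : 0 = c' := by simpa using hcw'
          simpa using ⟨hy, by linarith⟩
        · simp at hcw'
      · simpa using ⟨hv, hle⟩
    exact ⟨Relation.ReflTransGen.tail hu hD, hD.2.2⟩

theorem minEnergy_completion {W : ℤ} (hW : ∀ u v, |G.wt u v| ≤ W) (hM : (G.n + 1) * W < M) :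
    (G.completion s M).minEnergy (G.aliceCopy s M s) = G.minEnergy s :=
  eq_of_forall_ge_iff fun c => by
    cases c using ENat.recTopCoe with
    | top => simp
    | coe e => exact ⟨minEnergy_le_of_completion hW hM, minEnergy_completion_le hW hM⟩

end EnergyGame

end EnergyGames

namespace EnergyGames

/-! ### Counting steps instead of bits -/

theorem bitSize_le_iff {z : ℤ} {b : ℕ} : bitSize z ≤ b ↔ z.natAbs < 2 ^ b := Nat.size_le

theorem bitSize_natCast_le (m : ℕ) : bitSize (m : ℤ) ≤ m :=
  bitSize_le_iff.2 (by simpa using Nat.lt_two_pow_self)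

theorem bitSize_add_le {x y : ℤ} {b : ℕ} (hx : bitSize x ≤ b) (hy : bitSize y ≤ b) :
    bitSize (x + y) ≤ b + 1 := by
  rw [bitSize_le_iff] at *
  have := Int.natAbs_add_le x y
  rw [pow_succ]
  omega

theorem bitSize_sub_le {x y : ℤ} {b : ℕ} (hx : bitSize x ≤ b) (hy : bitSize y ≤ b) :
    bitSize (x - y) ≤ b + 1 := by
  rw [bitSize_le_iff] at *
  have := Int.natAbs_sub_le x y
  rw [pow_succ]
  omega

theorem length_le_listSize (l : List ℤ) : l.length ≤ listSize l := by
  induction l with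
  | nil => simp
  | cons a l ih => simp only [listSize, List.map_cons, List.sum_cons, List.length_cons] at *; omega

theorem bitSize_le_listSize {l : List ℤ} {z : ℤ} (hz : z ∈ l) : bitSize z ≤ listSize l :=
  (Nat.le_succ _).trans
    (List.single_le_sum (fun _ _ => Nat.zero_le _) _
      (List.mem_map_of_mem (f := fun z => bitSize z + 1) hz))

theorem listSize_le {l : List ℤ} {m b : ℕ} (hl : l.length ≤ m) (hb : ∀ z ∈ l, bitSize z ≤ b) :
    listSize l ≤ m * (b + 1) := by
  have := List.sum_le_card_nsmul (l.map fun z => bitSize z + 1) (b + 1) fun x hx => by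
    obtain ⟨z, hz, rfl⟩ := List.mem_map.1 hx
    exact Nat.succ_le_succ (hb z hz)
  rw [List.length_map, smul_eq_mul] at this
  exact this.trans (Nat.mul_le_mul_right _ hl)

/-- All numbers of a state have at most `b` bits, and all arrays have length at most `b`. -/
structure Bounded (b : ℕ) (s : State) : Prop where
  reg : ∀ i, bitSize (s.reg i) ≤ b
  len : ∀ a, (s.arr a).length ≤ b
  arr : ∀ a, ∀ z ∈ s.arr a, bitSize z ≤ b

theorem Bounded.mono {b c : ℕ} {s : State} (h : Bounded b s) (hbc : b ≤ c) : Bounded c s :=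
  ⟨fun i => (h.reg i).trans hbc, fun a => (h.len a).trans hbc,
    fun a z hz => (h.arr a z hz).trans hbc⟩

theorem Bounded.getD {b : ℕ} {s : State} (h : Bounded b s) (a i : ℕ) :
    bitSize ((s.arr a).getD i 0) ≤ b := by
  rcases lt_or_ge i (s.arr a).length with hi | hi
  · rw [List.getD_eq_getElem _ _ hi]; exact h.arr a _ (List.getElem_mem hi)
  · rw [List.getD_eq_default _ _ hi]; simp [bitSize]

theorem Bounded.update_reg {b : ℕ} {s : State} (h : Bounded b s) (i : ℕ) {c : ℤ}
    (hc : bitSize c ≤ b) : Bounded b { s with reg := Function.update s.reg i c } :=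
  ⟨fun j => by
    rcases eq_or_ne j i with rfl | hj
    · simpa using hc
    · simpa [Function.update_of_ne hj] using h.reg j, h.len, h.arr⟩

theorem Bounded.update_arr {b : ℕ} {s : State} (h : Bounded b s) (a : ℕ) {l : List ℤ}
    (hl : l.length ≤ b) (hlb : ∀ z ∈ l, bitSize z ≤ b) :
    Bounded b { s with arr := Function.update s.arr a l } :=
  ⟨h.reg, fun j => by
    rcases eq_or_ne j a with rfl | hj
    · simpa using hl
    · simpa [Function.update_of_ne hj] using h.len j, fun j => by
    rcases eq_or_ne j a with rfl | hj
    · simpa using hlb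
    · simpa [Function.update_of_ne hj] using h.arr j⟩

/-- A bound for the time of one step in a state with bound `b`. -/
def stepCost (b : ℕ) : ℕ := 1 + b * (b + 1) + 2 * b

theorem stepCost_mono {b c : ℕ} (h : b ≤ c) : stepCost b ≤ stepCost c := by
  unfold stepCost; gcongr

/-- The program `p` turns the state `s` into `s'` within `k` steps, provided that the answers of
the oracle have size at most `B`. -/
def Does (B : ℕ) (O : List ℤ → List ℤ) (p : Prog) (k : ℕ) (s s' : State) : Prop :=
  ∀ b, B ≤ b → Bounded b s →
    ∃ t, Exec O p s t s' ∧ t ≤ k * stepCost (b + k) ∧ Bounded (b + k) s'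

section Does

variable {B : ℕ} {O : List ℤ → List ℤ} {p q : Prog} {k k₁ k₂ : ℕ} {s s₁ s₂ : State}

theorem Does.mono (h : Does B O p k₁ s s₁) (hk : k₁ ≤ k₂) : Does B O p k₂ s s₁ :=
  fun b hB hb => by
    obtain ⟨t, ht, htk, hb'⟩ := h b hB hb
    exact ⟨t, ht, htk.trans (Nat.mul_le_mul hk (stepCost_mono (by omega))), hb'.mono (by omega)⟩

theorem Does.cast (h : Does B O p k s s₁) (hs : s₁ = s₂) : Does B O p k s s₂ := hs ▸ h

/-- The second program starts from the bound `b + k₁` that the first one leaves behind. This is why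
`Does` speaks of all bounds `b` and not of a fixed one. -/
theorem Does.seq (h₁ : Does B O p k₁ s s₁) (h₂ : Does B O q k₂ s₁ s₂) :
    Does B O (.seq p q) (k₁ + k₂) s s₂ := fun b hB hb => by
  obtain ⟨t₁, ht₁, htk₁, hb₁⟩ := h₁ b hB hb
  obtain ⟨t₂, ht₂, htk₂, hb₂⟩ := h₂ (b + k₁) (by omega) hb₁
  refine ⟨t₁ + t₂, .seq ht₁ ht₂, ?_, hb₂.mono (by omega)⟩
  rw [Nat.add_mul, ← Nat.add_assoc]
  exact Nat.add_le_add (htk₁.trans (Nat.mul_le_mul_left _ (stepCost_mono (by omega)))) htk₂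

theorem test_cost_le {b : ℕ} (hb : Bounded b s) (i c : ℕ) (hbc : b ≤ c) :
    1 + bitSize (s.reg i) ≤ stepCost c := by
  have := (hb.reg i).trans hbc
  unfold stepCost
  nlinarith

theorem Does.branch_pos {i : ℕ} (hi : 0 < s.reg i) (h : Does B O p k s s₁) :
    Does B O (.branch i p q) (k + 1) s s₁ := fun b hB hb => by
  obtain ⟨t, ht, htk, hb'⟩ := h b hB hb
  refine ⟨_, .branch_pos hi ht, ?_, hb'.mono (by omega)⟩
  have h1 := test_cost_le hb i (b + (k + 1)) (by omega)
  have h2 : k * stepCost (b + k) ≤ k * stepCost (b + (k + 1)) :=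
    Nat.mul_le_mul_left _ (stepCost_mono (by omega))
  rw [Nat.add_mul]; omega

theorem Does.branch_nonpos {i : ℕ} (hi : s.reg i ≤ 0) (h : Does B O q k s s₁) :
    Does B O (.branch i p q) (k + 1) s s₁ := fun b hB hb => by
  obtain ⟨t, ht, htk, hb'⟩ := h b hB hb
  refine ⟨_, .branch_nonpos hi ht, ?_, hb'.mono (by omega)⟩
  have h1 := test_cost_le hb i (b + (k + 1)) (by omega)
  have h2 : k * stepCost (b + k) ≤ k * stepCost (b + (k + 1)) :=
    Nat.mul_le_mul_left _ (stepCost_mono (by omega))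
  rw [Nat.add_mul]; omega

theorem Does.branch {i : ℕ} (hp : 0 < s.reg i → Does B O p k₁ s s₁)
    (hq : s.reg i ≤ 0 → Does B O q k₂ s s₁) : Does B O (.branch i p q) (k₁ + k₂ + 1) s s₁ :=
  (lt_or_ge 0 (s.reg i)).elim
    (fun h => ((hp h).branch_pos h).mono (by omega))
    fun h => ((hq h).branch_nonpos h).mono (by omega)

/-- The sequence `S` prescribes the states between the rounds. Every round costs one extra step for
its test, and the final, failing test costs one more. -/
theorem Does.loop {i : ℕ} (m : ℕ) : ∀ {S : ℕ → State},
    (∀ j < m, 0 < (S j).reg i ∧ Does B O p k (S j) (S (j + 1))) → (S m).reg i ≤ 0 →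
      Does B O (.loop i p) (m * (k + 1) + 1) (S 0) (S m) := by
  induction m with
  | zero =>
    intro S _ hend b hB hb
    refine ⟨_, .loop_nonpos hend, ?_, hb.mono (by omega)⟩
    simpa using test_cost_le hb i _ (by omega)
  | succ m ih =>
    intro S h hend b hB hb
    obtain ⟨h0, h1⟩ := h 0 (Nat.succ_pos m)
    obtain ⟨t₁, ht₁, htk₁, hb₁⟩ := h1 b hB hb
    obtain ⟨t₂, ht₂, htk₂, hb₂⟩ := ih (S := fun j => S (j + 1))
      (fun j hj => h (j + 1) (by omega)) hend (b + k) (by omega) hb₁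
    refine ⟨_, .loop_pos h0 ht₁ ht₂, ?_, hb₂.mono (by rw [Nat.succ_mul]; omega)⟩
    have hK : (m + 1) * (k + 1) + 1 = k + 1 + (m * (k + 1) + 1) := by ring
    rw [hK]
    set K := m * (k + 1) + 1
    have e0 := test_cost_le hb i (b + (k + 1 + K)) (by omega)
    have e1 : k * stepCost (b + k) ≤ k * stepCost (b + (k + 1 + K)) :=
      Nat.mul_le_mul_left _ (stepCost_mono (by omega))
    have e2 : K * stepCost (b + k + K) ≤ K * stepCost (b + (k + 1 + K)) :=
      Nat.mul_le_mul_left _ (stepCost_mono (by omega))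
    rw [Nat.add_mul, Nat.add_mul]; omega

theorem Does.instr {c : Instr} (hcost : ∀ b, B ≤ b → Bounded b s → c.cost O s ≤ stepCost (b + 1))
    (heff : ∀ b, B ≤ b → Bounded b s → Bounded (b + 1) (c.effect O s)) :
    Does B O (.instr c) 1 s (c.effect O s) :=
  fun b hB hb => ⟨_, .instr c s, by simpa using hcost b hB hb, heff b hB hb⟩

/-- The answer may be long compared with the state; the condition `B ≤ b` in `Does` absorbs it. The
quadratic term of `stepCost` pays for reading the queried array. -/
theorem Does.query {a a' : ℕ} (h : listSize (O (s.arr a)) ≤ B) :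
    Does B O (.instr (.query a a')) 1 s ⟨s.reg, Function.update s.arr a' (O (s.arr a))⟩ :=
  Does.instr (c := .query a a') (fun b hB hb => by
    have := listSize_le (hb.len a) (hb.arr a)
    simp only [Instr.cost, stepCost]
    nlinarith) fun b hB hb => (hb.mono (Nat.le_succ b)).update_arr a'
      ((length_le_listSize _).trans (by omega))
      fun z hz => (bitSize_le_listSize hz).trans (by omega)

end Does

/-! ### Straight-line programs -/

/-- The state with registers `l` and arrays `A`. -/
def st (l : List ℤ) (A : ℕ → List ℤ) : State := ⟨fun i => l.getD i 0, A⟩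

/-- The basic instructions without oracle queries, with constants `0` and `1` only, which write to
the first `N` registers. -/
def Instr.IsSimple (N : ℕ) : Instr → Bool
  | const i c => i < N && (c == 0 || c == 1)
  | add i _ _ => i < N
  | sub i _ _ => i < N
  | length i _ => i < N
  | get i _ _ => i < N
  | put _ _ _ => false
  | push _ _ => true
  | clear _ => true
  | query _ _ => false

/-- The effect of a simple instruction on the registers. -/
@[simp] def Instr.regs (l : List ℤ) (A : ℕ → List ℤ) : Instr → List ℤ
  | const i c => l.set i c
  | add i j k => l.set i (l.getD j 0 + l.getD k 0)
  | sub i j k => l.set i (l.getD j 0 - l.getD k 0)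
  | length i a => l.set i ((A a).length : ℤ)
  | get i a j => l.set i ((A a).getD (l.getD j 0).toNat 0)
  | _ => l

/-- The effect of a simple instruction on the arrays. -/
@[simp] def Instr.arrs (l : List ℤ) (A : ℕ → List ℤ) : Instr → ℕ → List ℤ
  | push a i => Function.update A a (A a ++ [l.getD i 0])
  | clear a => Function.update A a []
  | _ => A

/-- The registers after a sequence of simple instructions. -/
@[simp] def regsAfter : List Instr → List ℤ → (ℕ → List ℤ) → List ℤ
  | [], l, _ => l
  | c :: cs, l, A => regsAfter cs (c.regs l A) (c.arrs l A)

/-- The arrays after a sequence of simple instructions. -/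
@[simp] def arrsAfter : List Instr → List ℤ → (ℕ → List ℤ) → ℕ → List ℤ
  | [], _, A => A
  | c :: cs, l, A => arrsAfter cs (c.regs l A) (c.arrs l A)

/-- A sequence of instructions as a program. -/
def block : Instr → List Instr → Prog
  | c, [] => .instr c
  | c, d :: cs => .seq (.instr c) (block d cs)

/-- `List.set` beyond the end of a list does nothing, so the list of registers must be long enough;
the programs below use 16 registers. -/
theorem update_getD (l : List ℤ) {i : ℕ} (hi : i < l.length) (c : ℤ) :
    Function.update (fun k => l.getD k 0) i c = fun k => (l.set i c).getD k 0 := by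
  funext k
  rcases eq_or_ne k i with rfl | hk
  · simp [hi]
  · simp [Function.update_of_ne hk, List.getD_eq_getElem?_getD, List.getElem?_set_ne hk.symm]

theorem Instr.length_regs (c : Instr) (l : List ℤ) (A : ℕ → List ℤ) :
    (c.regs l A).length = l.length := by
  cases c <;> simp [Instr.regs]

theorem Instr.IsSimple.effect {c : Instr} {l : List ℤ} (h : c.IsSimple l.length = true)
    (O : List ℤ → List ℤ) (A : ℕ → List ℤ) :
    c.effect O (st l A) = st (c.regs l A) (c.arrs l A) := by
  cases c <;> simp only [Instr.IsSimple, Bool.and_eq_true, decide_eq_true_eq,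
    Bool.false_eq_true] at h <;>
    simp only [Instr.effect, st, Instr.regs, Instr.arrs]
  · rw [update_getD _ h.1]
  all_goals rw [update_getD _ h]

theorem Instr.IsSimple.does {c : Instr} {N : ℕ} (h : c.IsSimple N = true) (B : ℕ)
    (O : List ℤ → List ℤ) (s : State) : Does B O (.instr c) 1 s (c.effect O s) := by
  refine Does.instr (fun b hB hb => ?_) (fun b hB hb => ?_)
  · have hreg := hb.reg
    cases c <;> simp only [Instr.IsSimple, Bool.and_eq_true, Bool.or_eq_true, beq_iff_eq,
      Bool.false_eq_true] at h <;> simp only [Instr.cost, stepCost]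
    case const i c =>
      rcases h.2 with rfl | rfl <;> simp [bitSize] <;> nlinarith
    case add i j k => have := hreg j; have := hreg k; nlinarith
    case sub i j k => have := hreg j; have := hreg k; nlinarith
    case length i a =>
      have := (bitSize_natCast_le (s.arr a).length).trans (hb.len a); nlinarith
    case get i a j => have := hreg j; have := hb.getD a (s.reg j).toNat; nlinarith
    case push a i => have := hreg i; nlinarith
    case clear a => nlinarith
  · have hreg := hb.reg
    have hb1 := hb.mono (Nat.le_succ b)
    cases c <;> simp only [Instr.IsSimple, Bool.and_eq_true, Bool.or_eq_true, beq_iff_eq,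
      Bool.false_eq_true] at h <;> simp only [Instr.effect]
    case const i c =>
      refine hb1.update_reg _ ?_
      rcases h.2 with rfl | rfl <;> simp [bitSize]
    case add i j k => exact hb1.update_reg _ (bitSize_add_le (hreg j) (hreg k))
    case sub i j k => exact hb1.update_reg _ (bitSize_sub_le (hreg j) (hreg k))
    case length i a =>
      exact hb1.update_reg _ ((bitSize_natCast_le _).trans (hb1.len a))
    case get i a j => exact hb1.update_reg _ (hb1.getD _ _)
    case push a i =>
      refine hb1.update_arr _ ?_ ?_
      · simpa using hb.len a
      · intro z hz
        rcases List.mem_append.1 hz with hz | hz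
        · exact hb1.arr a z hz
        · rw [List.mem_singleton.1 hz]; exact hb1.reg i
    case clear a => exact hb1.update_arr _ (by simp) (by simp)

/-- On an explicit list of registers the side condition holds by `rfl` and the final state is found
by `simp`, so straight-line code is verified by evaluation. -/
theorem Does.block {B : ℕ} {O : List ℤ → List ℤ} (c : Instr) (cs : List Instr) (l : List ℤ)
    (A : ℕ → List ℤ) (h : ((c :: cs).all fun c => c.IsSimple l.length) = true) :
    Does B O (block c cs) (cs.length + 1) (st l A)
      (st (regsAfter (c :: cs) l A) (arrsAfter (c :: cs) l A)) := by
  induction cs generalizing c l A with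
  | nil =>
    have hc : c.IsSimple l.length = true := by simpa using h
    exact (Instr.IsSimple.does hc B O _).cast (Instr.IsSimple.effect hc O A)
  | cons d cs ih =>
    rw [List.all_cons, Bool.and_eq_true] at h
    have h1 := (Instr.IsSimple.does h.1 B O (st l A)).cast (Instr.IsSimple.effect h.1 O A)
    have h2 := ih d (c.regs l A) (c.arrs l A) (by rw [c.length_regs]; exact h.2)
    have := h1.seq h2
    rw [Nat.add_comm] at this
    exact this

/-- The number of instructions of a program. -/
def Prog.size : Prog → ℕ
  | instr _ => 1
  | seq p q => p.size + q.size
  | branch _ p q => p.size + q.size + 1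
  | loop _ p => p.size + 1

theorem size_block (c : Instr) (cs : List Instr) : (block c cs).size = cs.length + 1 := by
  induction cs generalizing c with
  | nil => rfl
  | cons d cs ih => simp only [block, Prog.size, ih, List.length_cons]; omega

/-- The program `p` turns `s` into `s'` and executes every instruction at most once. -/
def DoesOnce (B : ℕ) (O : List ℤ → List ℤ) (p : Prog) (s s' : State) : Prop :=
  Does B O p p.size s s'

section DoesOnce

variable {B : ℕ} {O : List ℤ → List ℤ} {p q : Prog} {s s₁ s₂ : State}

theorem DoesOnce.seq (h₁ : DoesOnce B O p s s₁) (h₂ : DoesOnce B O q s₁ s₂) :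
    DoesOnce B O (.seq p q) s s₂ := Does.seq h₁ h₂

theorem DoesOnce.branch {i : ℕ} (hp : 0 < s.reg i → DoesOnce B O p s s₁)
    (hq : s.reg i ≤ 0 → DoesOnce B O q s s₁) : DoesOnce B O (.branch i p q) s s₁ :=
  Does.branch hp hq

theorem DoesOnce.cast (h : DoesOnce B O p s s₁) (hs : s₁ = s₂) : DoesOnce B O p s s₂ := hs ▸ h

theorem DoesOnce.block (c : Instr) (cs : List Instr) (l : List ℤ)
    (A : ℕ → List ℤ) (h : ((c :: cs).all fun c => c.IsSimple l.length) = true) :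
    DoesOnce B O (block c cs) (st l A)
      (st (regsAfter (c :: cs) l A) (arrsAfter (c :: cs) l A)) :=
  (Does.block c cs l A h).mono (size_block c cs).ge

end DoesOnce

@[simp] theorem st_reg (l : List ℤ) (A : ℕ → List ℤ) (i : ℕ) : (st l A).reg i = l.getD i 0 := rfl

/-- A loop in which every round appends to the array `o`. -/
theorem Does.pushLoop {B : ℕ} {O : List ℤ → List ℤ} {p : Prog} {k c o m : ℕ} {A : ℕ → List ℤ}
    {S : ℕ → List ℤ} {g : ℕ → List ℤ}
    (h : ∀ i < m, 0 < (S i).getD c 0 ∧ ∀ Y, Does B O p k (st (S i) (Function.update A o Y))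
      (st (S (i + 1)) (Function.update A o (Y ++ g i))))
    (hend : (S m).getD c 0 ≤ 0) (Y : List ℤ) :
    Does B O (.loop c p) (m * (k + 1) + 1) (st (S 0) (Function.update A o Y))
      (st (S m) (Function.update A o (Y ++ (List.range m).flatMap g))) := by
  have := Does.loop (B := B) (O := O) (p := p) (k := k) (i := c) m
    (S := fun i => st (S i) (Function.update A o (Y ++ (List.range i).flatMap g)))
    (fun i hi => ⟨(h i hi).1, ((h i hi).2 _).cast (by
      rw [List.range_succ, List.flatMap_append, List.append_assoc]; simp)⟩) hend
  simpa using this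

end EnergyGames

namespace EnergyGames

/-! ### The program that builds the completion -/

/-- The weight in the completed graph, read off an encoding `X` in which the owner of `u` is at
`own` and the entry for `(u, v)` is at `pos`. -/
def entryVal (X : List ℤ) (b : Bool) (s : ℕ) (res bad : ℤ) (own pos u v : ℕ) : ℤ :=
  if decide (0 < X.getD own 0) = b then
    if 0 < X.getD pos 0 then X.getD (pos + 1) 0 else if v = s then res else bad
  else if u = v then 0 else if v = s then res else bad

/-- Appends the weight of a missing edge from `u` to `v`. -/
def missingProg (o : ℕ) : Prog :=
  .seq (block (.sub 10 6 2) []) (.branch 10 (block (.push o 4) [.const 10 0])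
    (.seq (block (.sub 10 2 6) []) (.branch 10 (block (.push o 4) [.const 10 0])
      (block (.push o 3) [.const 10 0]))))

/-- Appends the weight of the entry for `(u, v)`, or that of a missing edge. -/
def origProg (o : ℕ) : Prog :=
  .seq (block (.get 10 0 7) []) (.branch 10
    (block (.add 11 7 0) [.get 10 0 11, .push o 10, .const 10 0, .const 11 0]) (missingProg o))

/-- Appends the weight for a copy of `u` that does not belong to the owner of `u`. -/
def dummyProg (o : ℕ) : Prog :=
  .seq (block (.sub 10 5 6) []) (.branch 10 (missingProg o)
    (.seq (block (.sub 10 6 5) []) (.branch 10 (missingProg o)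
      (block (.push o 15) [.const 10 0]))))

/-- Appends an entry of a row of the player `b`, and moves on to the next one. -/
def entryProg (o : ℕ) (b : Bool) : Prog :=
  .seq (block (.push o 0) [.get 10 0 12])
    (.seq (.branch 10 (if b then origProg o else dummyProg o)
        (if b then dummyProg o else origProg o))
      (block (.add 6 6 0) [.add 7 7 0, .add 7 7 0, .sub 9 9 0]))

section Entry

variable {B : ℕ} {O : List ℤ → List ℤ} {A : ℕ → List ℤ} {o : ℕ}

/-- The registers keep these roles throughout: 0 and 15 hold the constants 1 and 0; 1 and 2 hold `n`
and `s`; 3 and 4 the weights `res` and `bad`; 5, 6 and 7 hold `u`, `v` and the position of their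
entry; 8 and 9 count down rows and columns; 10 and 11 are scratch; 12 is the position of the owner
of `u`; 13 is where the owners start; 14 counts rounds. Branching tests positivity only, so `v = s`
is tested by two subtractions. -/
theorem missingProg_does (n s : ℕ) (res bad : ℤ) (u v pos : ℕ) (cu cv x own b1 cs : ℤ)
    (Y : List ℤ) : DoesOnce B O (missingProg o)
      (st [1, n, s, res, bad, u, v, pos, cu, cv, x, 0, own, b1, cs, 0] (Function.update A o Y))
      (st [1, n, s, res, bad, u, v, pos, cu, cv, 0, 0, own, b1, cs, 0]
        (Function.update A o (Y ++ [if v = s then res else bad]))) := by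
  refine (DoesOnce.block _ _ _ _ rfl).seq (DoesOnce.branch (fun h => ?_) fun h =>
    (DoesOnce.block _ _ _ _ rfl).seq (DoesOnce.branch (fun h' => ?_) fun h' => ?_))
  · have hvs : ¬ v = s := by simp at h; omega
    exact (DoesOnce.block _ _ _ _ rfl).cast (by simp [hvs])
  · have hvs : ¬ v = s := by simp at h'; omega
    exact (DoesOnce.block _ _ _ _ rfl).cast (by simp [hvs])
  · have hvs : v = s := by simp at h h'; omega
    exact (DoesOnce.block _ _ _ _ rfl).cast (by simp [hvs])

theorem origProg_does (ho : o ≠ 0) (n s : ℕ) (res bad : ℤ) (u v pos : ℕ)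
    (cu cv x own b1 cs : ℤ) (Y : List ℤ) : DoesOnce B O (origProg o)
      (st [1, n, s, res, bad, u, v, pos, cu, cv, x, 0, own, b1, cs, 0] (Function.update A o Y))
      (st [1, n, s, res, bad, u, v, pos, cu, cv, 0, 0, own, b1, cs, 0]
        (Function.update A o (Y ++ [if 0 < (A 0).getD pos 0 then (A 0).getD (pos + 1) 0
          else if v = s then res else bad]))) := by
  have hpos : ((pos : ℤ) + 1).toNat = pos + 1 := rfl
  refine (DoesOnce.block _ _ _ _ rfl).seq (DoesOnce.branch (fun h => ?_) fun h => ?_)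
  · have h' : 0 < (A 0).getD pos 0 := by simpa [ho.symm] using h
    refine (DoesOnce.block _ _ _ _ rfl).cast ?_
    rw [if_pos h']
    simp [ho.symm, hpos]
  · have h' : ¬ 0 < (A 0).getD pos 0 := by simpa [ho.symm] using h
    rw [if_neg h']
    exact missingProg_does n s res bad u v pos _ _ _ _ _ _ _

theorem dummyProg_does (n s : ℕ) (res bad : ℤ) (u v pos : ℕ)
    (cu cv x own b1 cs : ℤ) (Y : List ℤ) : DoesOnce B O (dummyProg o)
      (st [1, n, s, res, bad, u, v, pos, cu, cv, x, 0, own, b1, cs, 0] (Function.update A o Y))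
      (st [1, n, s, res, bad, u, v, pos, cu, cv, 0, 0, own, b1, cs, 0]
        (Function.update A o (Y ++ [if u = v then 0 else if v = s then res else bad]))) := by
  refine (DoesOnce.block _ _ _ _ rfl).seq (DoesOnce.branch (fun h => ?_) fun h =>
    (DoesOnce.block _ _ _ _ rfl).seq (DoesOnce.branch (fun h' => ?_) fun h' => ?_))
  · have huv : ¬ u = v := by simp at h; omega
    rw [if_neg huv]
    exact missingProg_does n s res bad u v pos _ _ _ _ _ _ _
  · have huv : ¬ u = v := by simp at h'; omega
    rw [if_neg huv]
    exact missingProg_does n s res bad u v pos _ _ _ _ _ _ _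
  · have huv : u = v := by simp at h h'; omega
    exact (DoesOnce.block _ _ _ _ rfl).cast (by simp [huv])

/-- The number 100 is a generous bound for the size of the program, whose instructions are executed
at most once. -/
theorem entryProg_does (ho : o ≠ 0) (b : Bool) (n s : ℕ) (res bad : ℤ) (u v pos own : ℕ)
    (cu cv b1 cs : ℤ) (Y : List ℤ) : Does B O (entryProg o b) 100
      (st [1, n, s, res, bad, u, v, pos, cu, cv, 0, 0, own, b1, cs, 0] (Function.update A o Y))
      (st [1, n, s, res, bad, u, (v + 1 : ℕ), (pos + 2 : ℕ), cu, cv - 1, 0, 0, own, b1, cs, 0]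
        (Function.update A o (Y ++ [1, entryVal (A 0) b s res bad own pos u v]))) := by
  have h : DoesOnce B O (.branch 10 (if b then origProg o else dummyProg o)
      (if b then dummyProg o else origProg o))
      (st [1, n, s, res, bad, u, v, pos, cu, cv, (A 0).getD own 0, 0, own, b1, cs, 0]
        (Function.update A o (Y ++ [1])))
      (st [1, n, s, res, bad, u, v, pos, cu, cv, 0, 0, own, b1, cs, 0]
        (Function.update A o (Y ++ [1, entryVal (A 0) b s res bad own pos u v]))) := by
    have hY : ∀ z, Y ++ [1, z] = (Y ++ [1]) ++ [z] := fun z => by simp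
    rw [hY]
    unfold entryVal
    refine DoesOnce.branch (fun h => ?_) fun h => ?_
    · have h' : decide (0 < (A 0).getD own 0) = true := by simpa using h
      rw [h']
      cases b
      · exact dummyProg_does n s res bad u v pos _ _ _ _ _ _ _
      · exact origProg_does ho n s res bad u v pos _ _ _ _ _ _ _
    · have h' : decide (0 < (A 0).getD own 0) = false := by simpa using h
      rw [h']
      cases b
      · exact origProg_does ho n s res bad u v pos _ _ _ _ _ _ _
      · exact dummyProg_does n s res bad u v pos _ _ _ _ _ _ _
  refine Does.mono (((DoesOnce.block _ _ _ _ rfl).cast (by simp [ho.symm])).seq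
    (h.seq ((DoesOnce.block _ _ _ _ rfl).cast (by simp [add_assoc])))) ?_
  cases b <;> simp [Prog.size, block, origProg, dummyProg, missingProg]

/-- The entries for `u` in the rows of the player `b`. -/
def rowData (X : List ℤ) (b : Bool) (n s : ℕ) (res bad : ℤ) (own pos u : ℕ) : List ℤ :=
  (List.range n).flatMap fun v => [1, entryVal X b s res bad own (pos + 2 * v) u v]

/-- Appends the part of a row of the player `b` that contains edges. -/
def dataProg (o : ℕ) (b : Bool) : Prog :=
  .seq (block (.const 6 0) [.add 9 1 15]) (.seq (.loop 9 (entryProg o b)) (block (.const 6 0) []))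

theorem dataProg_does (ho : o ≠ 0) (b : Bool) (n s : ℕ) (res bad : ℤ) (u pos own : ℕ)
    (cu b1 cs : ℤ) (Y : List ℤ) : Does B O (dataProg o b) (101 * n + 4)
      (st [1, n, s, res, bad, u, 0, pos, cu, 0, 0, 0, own, b1, cs, 0] (Function.update A o Y))
      (st [1, n, s, res, bad, u, 0, (pos + 2 * n : ℕ), cu, 0, 0, 0, own, b1, cs, 0]
        (Function.update A o (Y ++ rowData (A 0) b n s res bad own pos u))) := by
  have h := Does.pushLoop (B := B) (O := O) (p := entryProg o b) (k := 100) (c := 9) (o := o)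
    (m := n) (A := A)
    (S := fun i => [1, n, s, res, bad, u, (i : ℕ), (pos + 2 * i : ℕ), cu, n - i, 0, 0, own,
      b1, cs, 0])
    (g := fun v => [1, entryVal (A 0) b s res bad own (pos + 2 * v) u v])
    (fun i hi => ⟨by simp; omega, fun Y =>
      (entryProg_does ho b n s res bad u i (pos + 2 * i) own cu (n - i) b1 cs Y).cast (by
        congr 2; push_cast; ring_nf)⟩)
    (by simp) Y
  refine Does.mono (((Does.block _ _ _ _ rfl).cast (by simp)).seq
    (h.seq ((Does.block _ _ _ _ rfl).cast (by simp [rowData])))) ?_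
  simp; omega

/-- A row of the player `b`. -/
def rowList (X : List ℤ) (b : Bool) (n s : ℕ) (res bad : ℤ) (own pos u : ℕ) : List ℤ :=
  let zeros := (List.range n).flatMap fun _ => [0, 0]
  if b then zeros ++ rowData X b n s res bad own pos u
  else rowData X b n s res bad own pos u ++ zeros

/-- Appends the part of a row without edges. -/
def zerosProg (o : ℕ) : Prog :=
  .seq (block (.add 9 1 15) []) (.loop 9 (block (.push o 15) [.push o 15, .sub 9 9 0]))

theorem zerosProg_does (n s : ℕ) (res bad : ℤ) (u pos own : ℕ) (cu b1 cs : ℤ) (Y : List ℤ) :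
    Does B O (zerosProg o) (4 * n + 2)
      (st [1, n, s, res, bad, u, 0, pos, cu, 0, 0, 0, own, b1, cs, 0] (Function.update A o Y))
      (st [1, n, s, res, bad, u, 0, pos, cu, 0, 0, 0, own, b1, cs, 0]
        (Function.update A o (Y ++ (List.range n).flatMap fun _ => [0, 0]))) := by
  have h := Does.pushLoop (B := B) (O := O) (p := block (.push o 15) [.push o 15, .sub 9 9 0])
    (k := 3) (c := 9) (o := o) (m := n) (A := A)
    (S := fun i => [1, n, s, res, bad, u, 0, pos, cu, n - i, 0, 0, own, b1, cs, 0])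
    (g := fun v => [0, 0])
    (fun i hi => ⟨by simp; omega, fun Y => (Does.block _ _ _ _ rfl).cast (by
        simp; ring_nf)⟩)
    (by simp) Y
  refine Does.mono (((Does.block _ _ _ _ rfl).cast (by simp)).seq (h.cast (by simp))) ?_
  simp; omega

/-- Appends a row of the player `b`, and moves on to the next one. -/
def rowProg (o : ℕ) (b : Bool) : Prog :=
  .seq (if b then .seq (zerosProg o) (dataProg o b) else .seq (dataProg o b) (zerosProg o))
    (block (.add 5 5 0) [.add 12 12 0, .sub 8 8 0])

theorem rowProg_does (ho : o ≠ 0) (b : Bool) (n s : ℕ) (res bad : ℤ) (u pos own : ℕ)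
    (cu b1 cs : ℤ) (Y : List ℤ) : Does B O (rowProg o b) (105 * n + 9)
      (st [1, n, s, res, bad, u, 0, pos, cu, 0, 0, 0, own, b1, cs, 0] (Function.update A o Y))
      (st [1, n, s, res, bad, (u + 1 : ℕ), 0, (pos + 2 * n : ℕ), cu - 1, 0, 0, 0, (own + 1 : ℕ), b1,
        cs, 0] (Function.update A o (Y ++ rowList (A 0) b n s res bad own pos u))) := by
  cases b
  · refine Does.mono (((dataProg_does ho false n s res bad u pos own cu b1 cs Y).seq
      (zerosProg_does n s res bad u (pos + 2 * n) own cu b1 cs _)).seq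
      ((Does.block _ _ _ _ rfl).cast ?_)) ?_
    · simp [rowList]
    · simp; omega
  · refine Does.mono (((zerosProg_does n s res bad u pos own cu b1 cs Y).seq
      (dataProg_does ho true n s res bad u pos own cu b1 cs _)).seq
      ((Does.block _ _ _ _ rfl).cast ?_)) ?_
    · simp [rowList]
    · simp; omega

/-- All rows of the player `b`. -/
def rowsList (X : List ℤ) (b : Bool) (n s : ℕ) (res bad : ℤ) (b1 : ℕ) : List ℤ :=
  (List.range n).flatMap fun u => rowList X b n s res bad (b1 + u) (b1 + n + 2 * n * u) u

/-- All rows of the player `b`; the sign of the weights of the missing edges is switched first. -/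
def rowsProg (o : ℕ) (b : Bool) : Prog :=
  .seq (block (.sub 3 15 3) [.add 4 3 3, .add 4 4 3, .add 12 13 15, .add 7 13 1, .const 5 0,
    .add 8 1 15]) (.seq (.loop 8 (rowProg o b))
      (block (.const 4 0) [.const 5 0, .const 7 0, .const 12 0]))

/-- The program runs first for Alice and then for Bob. Negating register 3 turns `M` into `-M` and
back, so each player gets the right sign and the register ends as it began. -/
theorem rowsProg_does (ho : o ≠ 0) (b : Bool) (n s b1 : ℕ) (res : ℤ) (cs : ℤ) (Y : List ℤ) :
    Does B O (rowsProg o b) (n * (105 * n + 10) + 12)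
      (st [1, n, s, res, 0, 0, 0, 0, 0, 0, 0, 0, 0, b1, cs, 0] (Function.update A o Y))
      (st [1, n, s, -res, 0, 0, 0, 0, 0, 0, 0, 0, 0, b1, cs, 0] (Function.update A o
        (Y ++ rowsList (A 0) b n s (-res) (-res + -res + -res) b1))) := by
  have h := Does.pushLoop (B := B) (O := O) (p := rowProg o b)
    (k := 105 * n + 9) (c := 8) (o := o) (m := n) (A := A)
    (S := fun i => [1, n, s, -res, -res + -res + -res, (i : ℕ), 0, (b1 + n + 2 * n * i : ℕ), n - i,
      0, 0, 0, (b1 + i : ℕ), b1, cs, 0])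
    (g := fun u => rowList (A 0) b n s (-res) (-res + -res + -res) (b1 + u) (b1 + n + 2 * n * u) u)
    (fun i hi => ⟨by simp; omega, fun Y => (rowProg_does ho b n s _ _ _ _ _ _ _ _ _).cast (by
        congr 2; push_cast; ring_nf)⟩)
    (by simp) Y
  refine Does.mono (((Does.block _ _ _ _ rfl).cast (by simp)).seq
    (h.seq ((Does.block _ _ _ _ rfl).cast (by simp [rowsList])))) ?_
  simp only [List.length_cons, List.length_nil, Nat.add_assoc, Nat.reduceAdd]; omega

/-- The encoding of the completed graph, computed from an encoding `X` of the graph whose owners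
start at `b1`. -/
def builtList (X : List ℤ) (n s b1 : ℕ) (M : ℤ) : List ℤ :=
  ((n : ℤ) + n) :: ((List.range n).flatMap (fun _ => [(1 : ℤ)]) ++
    (List.range n).flatMap (fun _ => [(0 : ℤ)]) ++
    rowsList X true n s (-M) (-M + -M + -M) b1 ++ rowsList X false n s M (M + M + M) b1)

/-- Appends the encoding of the completed graph to the array `o`. -/
def buildProg (o : ℕ) : Prog :=
  .seq (block (.add 10 1 1) [.push o 10, .const 10 0, .add 8 1 15])
    (.seq (.loop 8 (block (.push o 0) [.sub 8 8 0]))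
      (.seq (block (.add 8 1 15) [])
        (.seq (.loop 8 (block (.push o 15) [.sub 8 8 0]))
          (.seq (rowsProg o true) (rowsProg o false)))))

theorem buildProg_does (ho : o ≠ 0) (n s b1 : ℕ) (M cs : ℤ) (Y : List ℤ) :
    Does B O (buildProg o) (210 * n * n + 26 * n + 31)
      (st [1, n, s, M, 0, 0, 0, 0, 0, 0, 0, 0, 0, b1, cs, 0] (Function.update A o Y))
      (st [1, n, s, M, 0, 0, 0, 0, 0, 0, 0, 0, 0, b1, cs, 0]
        (Function.update A o (Y ++ builtList (A 0) n s b1 M))) := by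
  have h1 := Does.pushLoop (B := B) (O := O) (p := block (.push o 0) [.sub 8 8 0])
    (k := 2) (c := 8) (o := o) (m := n) (A := A)
    (S := fun i => [1, n, s, M, 0, 0, 0, 0, n - i, 0, 0, 0, 0, b1, cs, 0])
    (g := fun u => [1])
    (fun i hi => ⟨by simp; omega, fun Y => (Does.block _ _ _ _ rfl).cast (by simp; ring_nf)⟩)
    (by simp) (Y ++ [(n : ℤ) + n])
  have h2 := Does.pushLoop (B := B) (O := O) (p := block (.push o 15) [.sub 8 8 0])
    (k := 2) (c := 8) (o := o) (m := n) (A := A)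
    (S := fun i => [1, n, s, M, 0, 0, 0, 0, n - i, 0, 0, 0, 0, b1, cs, 0])
    (g := fun u => [0])
    (fun i hi => ⟨by simp; omega, fun Y => (Does.block _ _ _ _ rfl).cast (by simp; ring_nf)⟩)
    (by simp) (Y ++ [(n : ℤ) + n] ++ (List.range n).flatMap (fun _ => [(1 : ℤ)]))
  have h3 := rowsProg_does (B := B) (O := O) (A := A) ho true n s b1 M cs
    (Y ++ [(n : ℤ) + n] ++ (List.range n).flatMap (fun _ => [(1 : ℤ)]) ++
      (List.range n).flatMap (fun _ => [(0 : ℤ)]))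
  have h4 := rowsProg_does (B := B) (O := O) (A := A) ho false n s b1 (-M) cs
    (Y ++ [(n : ℤ) + n] ++ (List.range n).flatMap (fun _ => [(1 : ℤ)]) ++
      (List.range n).flatMap (fun _ => [(0 : ℤ)]) ++
      rowsList (A 0) true n s (-M) (-M + -M + -M) b1)
  refine Does.mono (((Does.block _ _ _ _ rfl).cast (by simp)).seq (h1.seq
    (((Does.block _ _ _ _ rfl).cast (by simp)).seq
      ((h2.cast (by simp)).seq (h3.seq (h4.cast (by simp [builtList]))))))) ?_
  simp; ring_nf; omega

/-- The sum of the absolute values, increased by one. -/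
def absSum (X : List ℤ) : ℕ := (X.map fun z => z.natAbs + 1).sum

theorem absSum_take_succ (X : List ℤ) {i : ℕ} (hi : i < X.length) :
    absSum (X.take (i + 1)) = absSum (X.take i) + ((X.getD i 0).natAbs + 1) := by
  simp only [absSum]
  rw [List.take_add_one, List.getElem?_eq_getElem hi, List.getD_eq_getElem _ _ hi, List.map_append,
    List.sum_append]
  rfl

/-- The number that is large compared to all numbers of `X`. -/
def bigNumber (X : List ℤ) : ℕ := X.length * absSum X

/-- Computes `bigNumber` of the input in register `3`. -/
def bigNumberProg : Prog :=
  .seq (block (.length 8 0) [])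
    (.seq (.loop 8 (.seq (block (.get 10 0 5) [.add 4 4 0])
      (.seq (.branch 10 (block (.add 4 4 10) []) (block (.sub 4 4 10) []))
        (block (.add 5 5 0) [.sub 8 8 0]))))
      (.seq (block (.const 10 0) [.const 5 0, .length 8 0])
        (.seq (.loop 8 (block (.add 3 3 4) [.sub 8 8 0])) (block (.const 4 0) []))))

/-- Multiplication is not an instruction; the second loop multiplies by repeated addition, once per
entry of the input. -/
theorem bigNumberProg_does (n s b1 : ℤ) :
    Does B O bigNumberProg (11 * (A 0).length + 10)
      (st [1, n, s, 0, 0, 0, 0, 0, 0, 0, 0, 0, 0, b1, 0, 0] A)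
      (st [1, n, s, bigNumber (A 0), 0, 0, 0, 0, 0, 0, 0, 0, 0, b1, 0, 0] A) := by
  set X := A 0 with hX
  have h1 := Does.loop (B := B) (O := O) (p := .seq (block (.get 10 0 5) [.add 4 4 0])
      (.seq (.branch 10 (block (.add 4 4 10) []) (block (.sub 4 4 10) []))
        (block (.add 5 5 0) [.sub 8 8 0]))) (k := 7) (i := 8) X.length
    -- Register 10 still holds the entry read in the preceding round, and 0 before the first one.
    (S := fun i => st [1, n, s, 0, (absSum (X.take i) : ℕ), (i : ℕ), 0, 0, X.length - i, 0,
      if i = 0 then 0 else X.getD (i - 1) 0, 0, 0, b1, 0, 0] A)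
    (fun i hi => ⟨by simp; omega, by
      have hT := absSum_take_succ X hi
      have hmid : DoesOnce B O (.branch 10 (block (.add 4 4 10) []) (block (.sub 4 4 10) []))
          (st [1, n, s, 0, (absSum (X.take i) : ℤ) + 1, (i : ℕ), 0, 0, X.length - i, 0, X.getD i 0, 0, 0,
            b1, 0, 0] A)
          (st [1, n, s, 0, (absSum (X.take (i + 1)) : ℕ), (i : ℕ), 0, 0, X.length - i, 0, X.getD i 0, 0, 0,
            b1, 0, 0] A) := by
        rw [hT]
        refine DoesOnce.branch (fun h => ?_) fun h => ?_
        · have h' : 0 < X.getD i 0 := h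
          have e : ((X.getD i 0).natAbs : ℤ) = X.getD i 0 := Int.natAbs_of_nonneg h'.le
          refine (DoesOnce.block _ _ _ _ rfl).cast ?_
          push_cast [e]
          simp; ring_nf
        · have h' : X.getD i 0 ≤ 0 := h
          have e : ((X.getD i 0).natAbs : ℤ) = -X.getD i 0 := Int.ofNat_natAbs_of_nonpos h'
          refine (DoesOnce.block _ _ _ _ rfl).cast ?_
          push_cast [e]
          simp; ring_nf
      refine Does.mono (((DoesOnce.block _ _ _ _ rfl).cast (by simp [← hX])).seq (hmid.seq
        ((DoesOnce.block _ _ _ _ rfl).cast (by simp; ring_nf)))) ?_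
      simp [Prog.size, block]⟩)
    (by simp)
  have h2 := Does.loop (B := B) (O := O) (p := block (.add 3 3 4) [.sub 8 8 0]) (k := 2) (i := 8)
    X.length
    (S := fun i => st [1, n, s, i * (absSum X : ℕ), (absSum X : ℕ), 0, 0, 0, X.length - i, 0,
      0, 0, 0, b1, 0, 0] A)
    (fun i hi => ⟨by simp; omega, (Does.block _ _ _ _ rfl).cast (by simp; ring_nf)⟩)
    (by simp)
  refine Does.mono (((Does.block _ _ _ _ rfl).cast (by simp [← hX, absSum])).seq (h1.seq
    (((Does.block _ _ _ _ rfl).cast (by simp [← hX])).seq (h2.seq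
      ((Does.block _ _ _ _ rfl).cast (by simp [bigNumber])))))) ?_
  simp; omega

end Entry

end EnergyGames

namespace EnergyGames

/-! ### Encodings -/

theorem finRange_add (m k : ℕ) : List.finRange (m + k) =
    (List.finRange m).map (Fin.castAdd k) ++ (List.finRange k).map (Fin.natAdd m) := by
  apply List.ext_getElem
  · simp
  · intro i h1 h2
    rw [List.getElem_append]
    split
    · simp
    · apply Fin.ext
      rename_i h
      simp only [List.length_map, List.length_finRange, not_lt] at h
      simp only [List.getElem_finRange, List.getElem_map, List.length_map, List.length_finRange,
        Fin.val_natAdd, Fin.val_cast]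
      omega

theorem flatMap_range (n : ℕ) (g : ℕ → List ℤ) :
    (List.range n).flatMap g = (List.finRange n).flatMap fun i : Fin n => g i := by
  have h : List.range n = (List.finRange n).map Fin.val :=
    List.ext_getElem (by simp) fun i h1 h2 => by simp
  rw [h, List.flatMap_map]

theorem length_flatMap_finRange {m c : ℕ} (f : Fin m → List ℤ) (hf : ∀ i, (f i).length = c) :
    ((List.finRange m).flatMap f).length = c * m := by
  simp [List.length_flatMap, hf, mul_comm]

theorem getD_flatMap_finRange {m c : ℕ} (f : Fin m → List ℤ) (hf : ∀ i, (f i).length = c)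
    (i : Fin m) {r : ℕ} (hr : r < c) :
    ((List.finRange m).flatMap f).getD (c * i + r) 0 = (f i).getD r 0 := by
  induction m with
  | zero => exact i.elim0
  | succ m ih =>
    rw [List.finRange_succ, List.flatMap_cons, List.flatMap_map]
    refine Fin.cases ?_ (fun j => ?_) i
    · rw [List.getD_append _ _ _ _ (by simp [hf, hr])]
      simp
    · rw [List.getD_append_right _ _ _ _ (by simp [hf]; nlinarith)]
      rw [hf, ← ih (fun i => f i.succ) (fun i => hf _) j]
      congr 1
      simp only [Fin.val_succ, Nat.mul_add, Nat.mul_one]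
      omega

namespace EnergyGame

variable (G : EnergyGame)

/-- The two numbers that encode an entry of the weighted adjacency matrix. -/
def encodeEntry : Option ℤ → List ℤ
  | some w => [1, w]
  | none => [0, 0]

theorem length_encodeEntry (w : Option ℤ) : (encodeEntry w).length = 2 := by cases w <;> rfl

theorem encode_eq : G.encode = (G.n : ℤ) ::
    ((List.finRange G.n).flatMap (fun u => [if G.alice u = true then (1 : ℤ) else 0]) ++
      (List.finRange G.n).flatMap fun u =>
        (List.finRange G.n).flatMap fun v => encodeEntry (G.weight u v)) := by
  rw [← List.map_eq_flatMap]
  rfl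

/-- The prefix `pre` is `[s]` for the decision problem and empty for the value problem. -/
theorem getD_owner (pre : List ℤ) (u : Fin G.n) :
    (pre ++ G.encode).getD (pre.length + 1 + u) 0 = if G.alice u = true then 1 else 0 := by
  rw [encode_eq, List.getD_append_right _ _ _ _ (by omega),
    show pre.length + 1 + u - pre.length = u + 1 by omega, List.getD_cons_succ,
    List.getD_append _ _ _ _ (by rw [length_flatMap_finRange (c := 1) _ fun _ => rfl]; omega)]
  have := getD_flatMap_finRange (c := 1) (fun u => [if G.alice u = true then (1 : ℤ) else 0])
    (fun _ => rfl) u (r := 0) (by omega)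
  simpa using this

theorem getD_entry (pre : List ℤ) (u v : Fin G.n) {r : ℕ} (hr : r < 2) :
    (pre ++ G.encode).getD (pre.length + 1 + G.n + 2 * G.n * u + 2 * v + r) 0 =
      (encodeEntry (G.weight u v)).getD r 0 := by
  have h1 := fun u : Fin G.n => length_flatMap_finRange (c := 2)
    (fun v => encodeEntry (G.weight u v)) fun _ => length_encodeEntry _
  rw [encode_eq, List.getD_append_right _ _ _ _ (by omega),
    show pre.length + 1 + G.n + 2 * G.n * u + 2 * v + r - pre.length =
      (G.n + (2 * G.n * u + (2 * v + r))) + 1 by omega, List.getD_cons_succ,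
    List.getD_append_right _ _ _ _ (by
      rw [length_flatMap_finRange (c := 1) _ fun _ => rfl]; omega),
    length_flatMap_finRange (c := 1) _ fun _ => rfl, one_mul, Nat.add_sub_cancel_left,
    getD_flatMap_finRange (c := 2 * G.n) _ h1 u (by omega),
    getD_flatMap_finRange (c := 2) _ (fun _ => length_encodeEntry _) v hr]

theorem entryVal_eq (pre : List ℤ) (b : Bool) (s u v : Fin G.n) (res bad : ℤ) :
    entryVal (pre ++ G.encode) b s res bad (pre.length + 1 + u)
      (pre.length + 1 + G.n + 2 * G.n * u + 2 * v) u v = G.fillWeight s b res bad u v := by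
  have h0 := G.getD_entry pre u v (r := 0) (by omega)
  have h1 := G.getD_entry pre u v (r := 1) (by omega)
  rw [Nat.add_zero] at h0
  unfold entryVal fillWeight copyWeight
  rw [G.getD_owner, h0, h1]
  have ha : (decide ((0 : ℤ) < if G.alice u = true then 1 else 0) = b) ↔ G.alice u = b := by
    cases G.alice u <;> simp
  simp only [ha, Fin.val_inj]
  by_cases hb : G.alice u = b
  · rw [if_pos hb, if_pos hb]
    cases G.weight u v <;> simp [encodeEntry]
  · rw [if_neg hb, if_neg hb]
    by_cases huv : u = v <;> simp [huv]

/-- Alice's copies are numbered first, so the edgeless half comes first in her rows and last in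
Bob's. -/
theorem builtList_eq (pre : List ℤ) (s : Fin G.n) (M : ℤ) :
    builtList (pre ++ G.encode) G.n s (pre.length + 1) M = (G.completion s M).encode := by
  have hsplit : List.finRange (G.completion s M).n =
      (List.finRange G.n).map (G.aliceCopy s M) ++ (List.finRange G.n).map (G.bobCopy s M) :=
    finRange_add _ _
  have hn : ((G.completion s M).n : ℤ) = G.n + G.n := Nat.cast_add _ _
  have hM : -M + -M + -M = -(M + M + M) := by ring
  rw [encode_eq (G.completion s M), hsplit, hn]
  simp only [builtList, rowsList, rowList, rowData, flatMap_range, entryVal_eq, hM,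
    List.flatMap_append, List.flatMap_map, alice_aliceCopy, alice_bobCopy,
    weight_aliceCopy_aliceCopy, weight_aliceCopy_bobCopy, weight_bobCopy_aliceCopy,
    weight_bobCopy_bobCopy, encodeEntry, if_true, Bool.false_eq_true, if_false, List.append_assoc]

end EnergyGame

end EnergyGames

namespace EnergyGames

/-! ### Sizes of numbers and of answers -/

/-- Bit lengths add up where the numbers are at worst multiplied. Hence `bigNumber` has polynomially
many bits. -/
theorem absSum_le (X : List ℤ) : absSum X ≤ 2 ^ listSize X := by
  induction X with
  | nil => simp [absSum]
  | cons a X ih =>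
    have h1 : a.natAbs < 2 ^ bitSize a := bitSize_le_iff.1 le_rfl
    have h2 : absSum (a :: X) = a.natAbs + 1 + absSum X := rfl
    have h3 : listSize (a :: X) = bitSize a + 1 + listSize X := rfl
    have h4 : 0 < 2 ^ listSize X := by positivity
    have h5 : 0 < 2 ^ bitSize a := by positivity
    rw [h2, h3, pow_add, pow_succ]
    nlinarith

theorem natAbs_getD_lt_absSum (X : List ℤ) (i : ℕ) (hX : 0 < X.length) :
    (X.getD i 0).natAbs < absSum X := by
  have key : ∀ z ∈ X, z.natAbs < absSum X := fun z hz =>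
    List.single_le_sum (fun _ _ => Nat.zero_le _) _
      (List.mem_map_of_mem (f := fun z : ℤ => z.natAbs + 1) hz)
  rcases lt_or_ge i X.length with hi | hi
  · rw [List.getD_eq_getElem _ _ hi]; exact key _ (List.getElem_mem hi)
  · rw [List.getD_eq_default _ _ hi]
    exact (Nat.zero_le _).trans_lt (key _ (List.getElem_mem hX))

namespace EnergyGame

variable (G : EnergyGame)

theorem length_encode : G.encode.length = 1 + G.n + 2 * G.n * G.n := by
  rw [encode_eq, List.length_cons, List.length_append,
    length_flatMap_finRange (c := 1) _ fun _ => rfl,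
    length_flatMap_finRange (c := 2 * G.n) _ fun u => length_flatMap_finRange (c := 2) _
      fun _ => length_encodeEntry _]
  ring

theorem abs_wt_le (pre : List ℤ) (u v : Fin G.n) : |G.wt u v| ≤ absSum (pre ++ G.encode) := by
  have h1 := G.getD_entry pre u v (r := 1) (by omega)
  have h2 : (encodeEntry (G.weight u v)).getD 1 0 = G.wt u v := by
    unfold wt
    cases G.weight u v <;> rfl
  rw [← h2, ← h1, Int.abs_eq_natAbs]
  exact_mod_cast (natAbs_getD_lt_absSum _ _ (by simp [length_encode])).le

/-- The encoding has `1 + n + 2n²` entries, more than `n + 1`, and `absSum` bounds every weight.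
This is the condition on `M` in `minEnergy_completion`. -/
theorem lt_bigNumber (pre : List ℤ) : ((G.n : ℤ) + 1) * absSum (pre ++ G.encode) <
    bigNumber (pre ++ G.encode) := by
  have hn := G.n_pos
  have hlen : G.n + 1 < (pre ++ G.encode).length := by
    rw [List.length_append, length_encode]; nlinarith
  have hpos : 0 < absSum (pre ++ G.encode) :=
    (Nat.zero_le _).trans_lt (natAbs_getD_lt_absSum _ 0 (by omega))
  unfold bigNumber
  exact_mod_cast Nat.mul_lt_mul_of_pos_right hlen hpos

theorem minEnergy_completion_bigNumber (pre : List ℤ) (s : Fin G.n) :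
    (G.completion s (bigNumber (pre ++ G.encode))).minEnergy
      (G.aliceCopy s (bigNumber (pre ++ G.encode)) s) = G.minEnergy s :=
  minEnergy_completion (G.abs_wt_le pre) (G.lt_bigNumber pre)

theorem abs_wt_completion_le {s : Fin G.n} {M W : ℤ} (hW : ∀ u v, |G.wt u v| ≤ W) (hWM : W ≤ M)
    (x y : Fin (G.completion s M).n) : |(G.completion s M).wt x y| ≤ M + M + M := by
  have hM : 0 ≤ M := ((abs_nonneg _).trans (hW s s)).trans hWM
  have key : ∀ b res bad u v, |res| ≤ M + M + M → |bad| ≤ M + M + M →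
      |G.fillWeight s b res bad u v| ≤ M + M + M := by
    intro b res bad u v h1 h2
    unfold fillWeight
    cases hc : G.copyWeight b u v with
    | none => rw [Option.getD_none]; split <;> assumption
    | some c => rw [Option.getD_some]; linarith [copyWeight_bound hW hc]
  have h1 : |M| ≤ M + M + M := by rw [abs_of_nonneg hM]; linarith
  have h3 : |M + M + M| ≤ M + M + M := by rw [abs_of_nonneg (by linarith)]
  rcases G.copy_cases s M x with ⟨u, rfl⟩ | ⟨u, rfl⟩ <;>
    rcases G.copy_cases s M y with ⟨v, rfl⟩ | ⟨v, rfl⟩ <;> unfold wt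
  · simpa using by linarith
  · simpa only [weight_aliceCopy_bobCopy, Option.getD_some] using
      key _ _ _ _ _ (by rwa [abs_neg]) (by rwa [abs_neg])
  · simpa only [weight_bobCopy_aliceCopy, Option.getD_some] using key _ _ _ _ _ h1 h3
  · simpa using by linarith

/-- The minimal energies of all nodes, with `-1` for infinity. -/
noncomputable def energies : List ℤ :=
  (List.finRange G.n).map fun s => if G.minEnergy s = ⊤ then -1 else ((G.minEnergy s).toNat : ℤ)

theorem listSize_energies_le {W b : ℕ} (hW : ∀ u v, |G.wt u v| ≤ W) (hb0 : 0 < b)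
    (hb : G.n * W < 2 ^ b) : listSize G.energies ≤ G.n * (b + 1) := by
  refine listSize_le (by simp [energies]) fun z hz => ?_
  obtain ⟨s, -, rfl⟩ := List.mem_map.1 hz
  rw [bitSize_le_iff]
  split
  -- The mark `-1` for infinity needs one bit, hence `0 < b`.
  · simpa using Nat.one_lt_two_pow hb0.ne'
  · exact (G.toNat_minEnergy_le s fun u v => (abs_le.1 (hW u v)).1).trans_lt hb

theorem n_le_listSize (pre : List ℤ) : G.n ≤ listSize (pre ++ G.encode) := by
  have := length_le_listSize (pre ++ G.encode)
  rw [List.length_append, length_encode] at this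
  omega

/-- The time of a query includes the length of its answer, so answers must be polynomially bounded.
-/
theorem listSize_energies_le_encode :
    listSize G.energies ≤ listSize G.encode * (2 * listSize G.encode + 2) := by
  have hn := G.n_le_listSize []
  have hW := G.abs_wt_le []
  rw [List.nil_append] at hn hW
  set ℓ := listSize G.encode
  refine (G.listSize_energies_le (b := 2 * ℓ + 1) hW (by omega) ?_).trans
    (Nat.mul_le_mul_right _ hn)
  have h1 : G.n < 2 ^ ℓ := hn.trans_lt Nat.lt_two_pow_self
  have h2 : absSum G.encode ≤ 2 ^ ℓ := absSum_le _
  have h3 : 2 ^ (2 * ℓ + 1) = 2 ^ ℓ * 2 ^ ℓ * 2 := by ring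
  rw [h3]
  have h4 : 0 < 2 ^ ℓ := by positivity
  have h5 := Nat.mul_le_mul h1.le h2
  have h6 : 0 < 2 ^ ℓ * 2 ^ ℓ := by positivity
  omega

theorem listSize_energies_completion_le (s : Fin G.n) :
    listSize (G.completion s (bigNumber G.encode)).energies ≤
      2 * listSize G.encode * (3 * listSize G.encode + 5) := by
  have hn := G.n_le_listSize []
  have hW := G.abs_wt_le []
  have hM := G.lt_bigNumber []
  have hL : G.encode.length ≤ listSize G.encode := length_le_listSize _
  have hS : absSum G.encode ≤ 2 ^ listSize G.encode := absSum_le _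
  rw [List.nil_append] at hn hW hM
  have hWM : (absSum G.encode : ℤ) ≤ bigNumber G.encode := by nlinarith
  have hb := G.abs_wt_completion_le (s := s) hW hWM
  have hMle : bigNumber G.encode = G.encode.length * absSum G.encode := rfl
  set ℓ := listSize G.encode
  have hn' : (G.completion s (bigNumber G.encode)).n = G.n + G.n := rfl
  -- There are `2n` nodes and weights up to `3M` with `M ≤ 2 ^ (2ℓ)`, so finite energies are at most
  -- `6 * 2 ^ (3ℓ)`, below `2 ^ (3ℓ + 4)`.
  refine (listSize_energies_le _ (W := bigNumber G.encode + bigNumber G.encode +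
    bigNumber G.encode) (b := 3 * ℓ + 4) (by exact_mod_cast hb) (by omega) ?_).trans
    (Nat.mul_le_mul_right _ (by omega))
  have h1 : G.n ≤ 2 ^ ℓ := (hn.trans_lt Nat.lt_two_pow_self).le
  have h2 : bigNumber G.encode ≤ 2 ^ ℓ * 2 ^ ℓ := by
    rw [hMle]
    exact Nat.mul_le_mul (hL.trans_lt Nat.lt_two_pow_self).le hS
  have h3 : 2 ^ (3 * ℓ + 4) = 2 ^ ℓ * (2 ^ ℓ * 2 ^ ℓ) * 16 := by ring
  have h5 := Nat.mul_le_mul h1 h2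
  have h6 : 0 < 2 ^ ℓ * (2 ^ ℓ * 2 ^ ℓ) := by positivity
  rw [h3, hn']
  nlinarith

end EnergyGame

/-! ### The reductions -/

/-- The arrays of a program that uses only four of them. -/
def arrays (X Y₁ Y₂ Y₃ : List ℤ) : ℕ → List ℤ
  | 0 => X
  | 1 => Y₁
  | 2 => Y₂
  | 3 => Y₃
  | _ => []

section Arrays

variable (X Y₁ Y₂ Y₃ Y : List ℤ)

@[simp] theorem arrays_zero : arrays X Y₁ Y₂ Y₃ 0 = X := rfl
@[simp] theorem arrays_one : arrays X Y₁ Y₂ Y₃ 1 = Y₁ := rfl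
@[simp] theorem arrays_two : arrays X Y₁ Y₂ Y₃ 2 = Y₂ := rfl
@[simp] theorem arrays_three : arrays X Y₁ Y₂ Y₃ 3 = Y₃ := rfl

@[simp] theorem update_arrays_one :
    Function.update (arrays X Y₁ Y₂ Y₃) 1 Y = arrays X Y Y₂ Y₃ := by
  funext a
  match a with
  | 0 | 1 | 2 | 3 | _ + 4 => rfl

@[simp] theorem update_arrays_two :
    Function.update (arrays X Y₁ Y₂ Y₃) 2 Y = arrays X Y₁ Y Y₃ := by
  funext a
  match a with
  | 0 | 1 | 2 | 3 | _ + 4 => rfl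

@[simp] theorem update_arrays_three :
    Function.update (arrays X Y₁ Y₂ Y₃) 3 Y = arrays X Y₁ Y₂ Y := by
  funext a
  match a with
  | 0 | 1 | 2 | 3 | _ + 4 => rfl

end Arrays

theorem initState_eq (x : List ℤ) :
    initState x = st [0, 0, 0, 0, 0, 0, 0, 0, 0, 0, 0, 0, 0, 0, 0, 0] (arrays x [] [] []) := by
  have h1 : (fun _ : ℕ => (0 : ℤ)) = fun i =>
      [0, 0, 0, 0, 0, 0, 0, 0, 0, 0, 0, 0, 0, 0, 0, 0].getD i 0 := by
    funext i
    have : [0, 0, 0, 0, 0, 0, 0, 0, 0, 0, 0, 0, 0, 0, 0, 0] = List.replicate 16 (0 : ℤ) := rfl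
    rw [this, List.getD_eq_getElem?_getD, List.getElem?_replicate]
    split <;> rfl
  have h2 : (fun a => if a = 0 then x else []) = arrays x [] [] [] := by
    funext a
    match a with
    | 0 | 1 | 2 | 3 | _ + 4 => rfl
  unfold initState st
  rw [h1, h2]

open Polynomial in
/-- A time bound for `k` steps with answers of the oracle of size at most `B`. -/
noncomputable def timeBound (k B : ℕ[X]) : ℕ[X] :=
  k * (1 + (B + X + k) * (B + X + k + 1) + 2 * (B + X + k))

/-- The initial state is bounded by the size of the input; adding the bound on the answers gives an
admissible `b`. -/
theorem Does.runsTo {B k : ℕ} {O : List ℤ → List ℤ} {p : Prog} {x : List ℤ} {s : State}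
    (h : Does B O p k (initState x) s) {kp Bp : Polynomial ℕ} (hk : k ≤ kp.eval (listSize x))
    (hB : B ≤ Bp.eval (listSize x)) :
    RunsTo O p x (s.arr 1) ((timeBound kp Bp).eval (listSize x)) := by
  have hb : Bounded (Bp.eval (listSize x) + listSize x) (initState x) := by
    refine ⟨fun i => by simp [initState, bitSize], fun a => ?_, fun a z hz => ?_⟩
    · simp only [initState]
      split
      · exact (length_le_listSize x).trans (by omega)
      · simp
    · simp only [initState] at hz
      split at hz
      · exact (bitSize_le_listSize hz).trans (by omega)
      · simp at hz
  obtain ⟨t, ht, htk, -⟩ := h.mono hk _ (by omega) hb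
  refine ⟨t, s, ht, rfl, htk.trans (le_of_eq ?_)⟩
  simp [timeBound, stepCost]

/-- Copies the input to the output. -/
def copyProg : Prog :=
  .seq (block (.const 0 1) [.length 8 0])
    (.loop 8 (block (.get 10 0 5) [.push 1 10, .add 5 5 0, .sub 8 8 0]))

theorem copyProg_does (O : List ℤ → List ℤ) (x : List ℤ) :
    ∃ s, Does 0 O copyProg (5 * x.length + 3) (initState x) s ∧ s.arr 1 = x := by
  rw [initState_eq]
  have h := Does.pushLoop (B := 0) (O := O)
    (p := block (.get 10 0 5) [.push 1 10, .add 5 5 0, .sub 8 8 0])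
    (k := 4) (c := 8) (o := 1) (m := x.length) (A := arrays x [] [] [])
    (S := fun i => [1, 0, 0, 0, 0, (i : ℕ), 0, 0, x.length - i, 0,
      if i = 0 then 0 else x.getD (i - 1) 0, 0, 0, 0, 0, 0])
    (g := fun i => [x.getD i 0])
    (fun i hi => ⟨by simp; omega, fun Y => (Does.block _ _ _ _ rfl).cast (by
      simp; ring_nf)⟩)
    (by simp) []
  refine ⟨_, Does.mono (((Does.block _ _ _ _ rfl).cast ?_).seq h) ?_, ?_⟩
  · simp
  · simp; omega
  · have hx : (List.range x.length).flatMap (fun i => [x.getD i 0]) = x := by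
      rw [← List.map_eq_flatMap]
      exact List.ext_getElem (by simp) fun i h1 h2 => by simp [h2]
    rw [hx]; rfl

/-- The reduction for the decision problem. -/
def decisionProg : Prog :=
  .seq (block (.const 0 1) [.add 13 0 0, .get 2 0 15, .get 1 0 0])
    (.seq bigNumberProg (.seq (block (.push 1 2) []) (buildProg 1)))

theorem decisionProg_does (O : List ℤ → List ℤ) (G : EnergyGame) (s : Fin G.n) :
    ∃ s', Does 0 O decisionProg
        (210 * G.n * G.n + 26 * G.n + 11 * ((s : ℤ) :: G.encode).length + 46)
        (initState ((s : ℤ) :: G.encode)) s' ∧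
      s'.arr 1 = (s : ℤ) :: (G.completion s (bigNumber ((s : ℤ) :: G.encode))).encode := by
  rw [initState_eq]
  set X := (s : ℤ) :: G.encode with hX
  have hget0 : X.getD 0 0 = s := rfl
  have hget1 : X.getD 1 0 = G.n := rfl
  have h1 := bigNumberProg_does (B := 0) (O := O) (A := arrays X [] [] []) G.n s 2
  have h2 := buildProg_does (B := 0) (O := O) (A := arrays X [] [] []) (o := 1) one_ne_zero G.n s 2
    (bigNumber X) 0 [(s : ℤ)]
  refine ⟨_, Does.mono (((Does.block _ _ _ _ rfl).cast ?_).seq (h1.seq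
    (((Does.block _ _ _ _ rfl).cast ?_).seq h2))) ?_, ?_⟩
  · simp only [regsAfter, arrsAfter, Instr.regs, Instr.arrs, List.set_cons_zero,
      List.set_cons_succ, List.getD_cons_zero, List.getD_cons_succ, arrays_zero]
    rw [show (0 : ℤ).toNat = 0 from rfl, show (1 : ℤ).toNat = 1 from rfl, hget0, hget1]
    rfl
  · simp
  · simp; omega
  · have := G.builtList_eq [(s : ℤ)] s (bigNumber X)
    simp only [List.singleton_append, List.length_singleton, Nat.reduceAdd] at this
    simp only [st, update_arrays_one, arrays_one, arrays_zero]
    rw [hX] at *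
    rw [this, List.singleton_append]

open Polynomial in
theorem manyOneReducible_of_completeBipartite {C : EnergyGame → Prop}
    (hC : ∀ G : EnergyGame, G.graph.IsCompleteBipartite → C G) :
    ManyOneReducible (decisionProblem fun _ => True) (decisionProblem C) := by
  refine ⟨decisionProg, timeBound (210 * X * X + 37 * X + 46) 0, ?_⟩
  rintro ⟨⟨G, s⟩, -⟩
  set x := (s : ℤ) :: G.encode with hx
  -- Alice's copy of `s` has the same number `s`, so the first entry of the input is passed on
  -- unchanged.
  refine ⟨⟨⟨G.completion s (bigNumber x), G.aliceCopy s _ s⟩,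
    hC _ (G.completion_isCompleteBipartite s _)⟩, ?_, ?_⟩
  · obtain ⟨s', h, hs'⟩ := decisionProg_does (fun _ => []) G s
    have hn := G.n_le_listSize [(s : ℤ)]
    have hl := length_le_listSize x
    have := h.runsTo (kp := 210 * X * X + 37 * X + 46) (Bp := 0) (by
      rw [List.singleton_append, ← hx] at hn
      simp only [eval_add, eval_mul, eval_X, eval_ofNat]
      rw [← hx]
      have := Nat.mul_le_mul hn hn
      nlinarith) (Nat.zero_le _)
    rw [hs'] at this
    exact this
  · have := G.minEnergy_completion_bigNumber [(s : ℤ)] s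
    exact (not_congr (by rw [← this]; rfl))

open Polynomial in
theorem manyOneReducible_general (C : EnergyGame → Prop) :
    ManyOneReducible (decisionProblem C) (decisionProblem fun _ => True) := by
  refine ⟨copyProg, timeBound (5 * X + 3) 0, fun x => ⟨⟨x.1, trivial⟩, ?_, Iff.rfl⟩⟩
  obtain ⟨s', h, hs'⟩ := copyProg_does (fun _ => []) ((decisionProblem C).encode x)
  have hl := length_le_listSize ((decisionProblem C).encode x)
  have := h.runsTo (kp := 5 * X + 3) (Bp := 0) (by
    simp only [eval_add, eval_mul, eval_X, eval_ofNat]; omega) (Nat.zero_le _)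
  rw [hs'] at this
  exact this

open Polynomial in
theorem turingReducible_general (C : EnergyGame → Prop) :
    TuringReducible (valueProblem C) (valueProblem fun _ => True) := by
  refine ⟨.instr (.query 0 1), timeBound 1 (X * (2 * X + 2)), fun O hO G => ?_⟩
  have hans : O G.1.encode = G.1.energies := hO ⟨G.1, trivial⟩
  have hB := G.1.listSize_energies_le_encode
  have h := Does.query (B := listSize G.1.energies) (O := O) (s := initState G.1.encode)
    (a := 0) (a' := 1) (by
      change listSize (O G.1.encode) ≤ _
      rw [hans])
  have := h.runsTo (kp := 1) (Bp := X * (2 * X + 2)) (by simp) (by simpa using hB)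
  have harr : (⟨(initState G.1.encode).reg, Function.update (initState G.1.encode).arr 1
      (O ((initState G.1.encode).arr 0))⟩ : State).arr 1 = G.1.energies := hans
  rw [harr] at this
  exact this

/-- One round of the reduction for the value problem. -/
def valueRoundProg : Prog :=
  .seq (block (.clear 2) []) (.seq (buildProg 2) (.seq (.instr (.query 2 3))
    (block (.get 10 3 2) [.push 1 10, .const 10 0, .add 2 2 0, .sub 14 14 0])))

/-- The reduction for the value problem. -/
def valueProg : Prog :=
  .seq (block (.const 0 1) [.add 13 0 15, .get 1 0 15])
    (.seq bigNumberProg (.seq (block (.add 14 1 15) []) (.loop 14 valueRoundProg)))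

/-- One round contributes the energy of one node `s`: of the whole answer about the completion at
`s`, only the entry with index `s`, which is Alice's copy of `s`, is kept. -/
theorem valueRoundProg_does {B : ℕ} {O : List ℤ → List ℤ} {G : EnergyGame} (s : Fin G.n) {M : ℤ}
    (hO : O (G.completion s M).encode = (G.completion s M).energies)
    (hB : listSize (G.completion s M).energies ≤ B)
    (hM : (G.completion s M).minEnergy (G.aliceCopy s M s) = G.minEnergy s)
    (cs : ℤ) (Y₁ Y₂ Y₃ : List ℤ) :
    Does B O valueRoundProg (210 * G.n * G.n + 26 * G.n + 38)
      (st [1, G.n, (s : ℕ), M, 0, 0, 0, 0, 0, 0, 0, 0, 0, (1 : ℕ), cs, 0]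
        (arrays G.encode Y₁ Y₂ Y₃))
      (st [1, G.n, (s + 1 : ℕ), M, 0, 0, 0, 0, 0, 0, 0, 0, 0, (1 : ℕ), cs - 1, 0]
        (arrays G.encode (Y₁ ++ [G.energies.getD s 0]) (G.completion s M).encode
          (G.completion s M).energies)) := by
  have h1 := buildProg_does (B := B) (O := O) (A := arrays G.encode Y₁ [] Y₃) (o := 2) two_ne_zero
    G.n s 1 M cs []
  have hbuilt : builtList G.encode G.n s 1 M = (G.completion s M).encode := G.builtList_eq [] s M
  simp only [update_arrays_two, arrays_zero, List.nil_append, hbuilt] at h1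
  have h2 := Does.query (B := B) (O := O) (a := 2) (a' := 3)
    (s := st [1, G.n, (s : ℕ), M, 0, 0, 0, 0, 0, 0, 0, 0, 0, (1 : ℕ), cs, 0]
      (arrays G.encode Y₁ (G.completion s M).encode Y₃)) (by
        change listSize (O (G.completion s M).encode) ≤ B
        rwa [hO])
  have h2' := h2.cast (s₂ := st [1, G.n, (s : ℕ), M, 0, 0, 0, 0, 0, 0, 0, 0, 0, (1 : ℕ), cs, 0]
      (arrays G.encode Y₁ (G.completion s M).encode (G.completion s M).energies)) (by
        simp only [st, arrays_two, hO, update_arrays_three])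
  have hget : (G.completion s M).energies.getD s 0 = G.energies.getD s 0 := by
    have e1 := List.getD_eq_getElem (G.completion s M).energies 0
      (n := (s : ℕ)) (by simp [EnergyGame.energies]; exact (G.aliceCopy s M s).2)
    have e2 := List.getD_eq_getElem G.energies 0 (n := (s : ℕ)) (by simp [EnergyGame.energies])
    rw [e1, e2]
    simp only [EnergyGame.energies, List.getElem_map, List.getElem_finRange]
    change (if (G.completion s M).minEnergy (G.aliceCopy s M s) = ⊤ then _ else
      (((G.completion s M).minEnergy (G.aliceCopy s M s)).toNat : ℤ)) = _
    rw [hM]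
    rfl
  refine Does.mono (((Does.block _ _ _ _ rfl).cast ?_).seq (h1.seq (h2'.seq
    ((Does.block _ _ _ _ rfl).cast ?_)))) ?_
  · simp
  · rw [← hget]; simp
  · simp; omega

theorem valueProg_does {B : ℕ} {O : List ℤ → List ℤ} {G : EnergyGame}
    (hO : ∀ s : Fin G.n, O (G.completion s (bigNumber G.encode)).encode =
      (G.completion s (bigNumber G.encode)).energies)
    (hB : ∀ s : Fin G.n, listSize (G.completion s (bigNumber G.encode)).energies ≤ B) :
    ∃ s', Does B O valueProg (G.n * (210 * G.n * G.n + 26 * G.n + 39) + 11 * G.encode.length + 15)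
        (initState G.encode) s' ∧ s'.arr 1 = G.energies := by
  rw [initState_eq]
  have hget : G.encode.getD 0 0 = G.n := rfl
  have h1 := bigNumberProg_does (B := B) (O := O) (A := arrays G.encode [] [] []) G.n 0 1
  have hlen : G.energies.length = G.n := by simp [EnergyGame.energies]
  -- The game queried in round `i`, made total by a value that is never used. After the round,
  -- arrays 2 and 3 still hold its encoding and its energies.
  let E : ℕ → EnergyGame := fun i =>
    if h : i < G.n then G.completion ⟨i, h⟩ (bigNumber G.encode) else G
  have hE : ∀ s : Fin G.n, E s = G.completion s (bigNumber G.encode) := fun s => dif_pos s.2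
  have h2 := Does.loop (B := B) (O := O) (p := valueRoundProg)
    (k := 210 * G.n * G.n + 26 * G.n + 38) (i := 14) G.n
    (S := fun i => st [1, G.n, (i : ℕ), bigNumber G.encode, 0, 0, 0, 0, 0, 0, 0, 0, 0, (1 : ℕ),
      G.n - i, 0] (arrays G.encode (G.energies.take i) (if i = 0 then [] else (E (i - 1)).encode)
        (if i = 0 then [] else (E (i - 1)).energies)))
    (fun i hi => ⟨by simp; omega, by
      refine (valueRoundProg_does ⟨i, hi⟩ (hO _) (hB _)
        (G.minEnergy_completion_bigNumber [] _) _ _ _ _).cast ?_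
      have := hE ⟨i, hi⟩
      simp only [Nat.add_sub_cancel, Nat.succ_ne_zero, if_false]
      simp only at this
      rw [this, List.take_add_one, List.getElem?_eq_getElem (by omega),
        List.getD_eq_getElem _ _ (by simpa [hlen] using hi)]
      congr 2
      push_cast; ring_nf⟩)
    (by simp)
  refine ⟨_, Does.mono (((Does.block _ _ _ _ rfl).cast ?_).seq (h1.seq
    (((Does.block _ _ _ _ rfl).cast ?_).seq h2))) ?_, ?_⟩
  · simp only [regsAfter, arrsAfter, Instr.regs, Instr.arrs, List.set_cons_zero,
      List.set_cons_succ, List.getD_cons_zero, List.getD_cons_succ, arrays_zero]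
    rw [show (0 : ℤ).toNat = 0 from rfl, hget]
    rfl
  · simp
  · simp only [List.length_cons, List.length_nil, Nat.add_assoc, Nat.reduceAdd, arrays_zero]
    omega
  · change G.energies.take G.n = G.energies
    rw [← hlen, List.take_length]

open Polynomial in
theorem turingReducible_of_completeBipartite {C : EnergyGame → Prop}
    (hC : ∀ G : EnergyGame, G.graph.IsCompleteBipartite → C G) :
    TuringReducible (valueProblem fun _ => True) (valueProblem C) := by
  refine ⟨valueProg, timeBound (X * (210 * X * X + 26 * X + 39) + 11 * X + 15)
    (2 * X * (3 * X + 5)), ?_⟩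
  rintro O hO ⟨G, -⟩
  obtain ⟨s', h, hs'⟩ := valueProg_does (O := O) (G := G)
    (fun s => hO ⟨_, hC _ (G.completion_isCompleteBipartite s _)⟩)
    (fun s => G.listSize_energies_completion_le s)
  have hn := G.n_le_listSize []
  rw [List.nil_append] at hn
  have hl := length_le_listSize G.encode
  have := h.runsTo (kp := X * (210 * X * X + 26 * X + 39) + 11 * X + 15)
    (Bp := 2 * X * (3 * X + 5)) (by
      simp only [eval_add, eval_mul, eval_X, eval_ofNat]
      gcongr) (by simp)
  rw [hs'] at this
  exact this

theorem asHardAsGeneral_of_completeBipartite {C : EnergyGame → Prop}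
    (hC : ∀ G : EnergyGame, G.graph.IsCompleteBipartite → C G) : AsHardAsGeneral C :=
  ⟨⟨manyOneReducible_of_completeBipartite hC, manyOneReducible_general C⟩,
    turingReducible_of_completeBipartite hC, turingReducible_general C⟩

end EnergyGames

theorem mainTheorem5 :
    (∀ k : ℕ, 2 ≤ k →
      EnergyGames.AsHardAsGeneral fun G => G.graph.cliqueWidth ≤ (k : ℕ∞)) ∧
    (EnergyGames.AsHardAsGeneral fun G => G.graph.IsStronglyErgodic) ∧
    (EnergyGames.AsHardAsGeneral fun G => G.graph.IsCompleteBipartite) ∧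
    (∀ G : EnergyGames.EnergyGame, G.graph.IsCompleteBipartite →
      G.graph.cliqueWidth = 2 ∧ G.graph.IsStronglyErgodic) :=
  ⟨fun k hk => EnergyGames.asHardAsGeneral_of_completeBipartite fun G hG => by
      rw [G.cliqueWidth_eq_two hG]; exact_mod_cast hk,
    EnergyGames.asHardAsGeneral_of_completeBipartite fun _ hG => hG.isStronglyErgodic,
    EnergyGames.asHardAsGeneral_of_completeBipartite fun _ hG => hG,
    fun G hG => ⟨G.cliqueWidth_eq_two hG, hG.isStronglyErgodic⟩⟩
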